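/- Conventions. A perm is a permutation of the positive integers; products are read from left to right ($\alpha\beta$ means first $\alpha$, then $\beta$), and $\alpha^-$ is the inverse of $\alpha$. $\Pi(k)$ is the set of perms fixing all points $>k$. The data structure consists, for each $k$, of slots $\sigma_{kj}$ ($1\le j\le k$), each empty or a perm of $\Pi(k)$ taking $k\mapsto j$, with $\sigma_{kk}$ the identity, and of a list $T(k)\subseteq\Pi(k)$; initially all $\sigma_{kj}$ with $j<k$ and all $T(k)$ are empty. $\Sigma(k)$ is the list of the nonempty $\sigma_{kj}$. Both lists are kept in order of insertion. Membership test "$\pi\in\Gamma(k)$?": for $l=k,k-1,\dots,1$ let $j_l$ be the image of $l$ under the current perm (initially $\pi$); if $\sigma_{lj_l}$ is empty, answer no; otherwise multiply the current perm on the right by $\sigma_{lj_l}^-$. If all levels are passed, answer yes. Recursive procedures. $A_k(\pi)$: append $\pi$ to $T(k)$, then perform $B_k(\sigma\pi)$ for all $\sigma$ in the current $\Sigma(k)$. $B_k(\pi)$: let $\pi$ take $k\mapsto j$; if $\sigma_{kj}$ is empty, set $\sigma_{kj}\gets\pi$, perform $B_k(\pi\tau)$ for all $\tau$ in the current $T(k)$,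 and stop; otherwise stop if $\pi\sigma_{kj}^-\in\Gamma(k-1)$, and else perform $A_{k-1}(\pi\sigma_{kj}^-)$. Given an input $(\pi_2,\dots,\pi_n)$ with $\pi_k\in\Pi(k)$ and $\pi_k\colon k\mapsto k-1$, the computation takes $\pi_2,\pi_3,\dots,\pi_n$ in this order, tests each for membership in $\Gamma(n)$, and performs $A_n(\pi_k)$ if the test fails. The running time counts elementary steps: forming a product of two perms of $\Pi(l)$, or storing a perm in a slot $\sigma_{lj}$, costs $l$ steps (multiplication by $\sigma_{ll}^-$, the identity, is free), reading a generator costs $n$ steps, inspecting or initializing a slot costs one step, and so does inserting a pointer into a list $T(k)$. Theorem. The computation terminates for every $n$ and every input. Let the $1!\,2!\cdots(n-1)!$ inputs be equally likely. Then: (a) the average running time is $\Theta(n^5)$ as $n\to\infty$; (b) let $n\ge k>j>i>1$ and $k>l>i$, and consider the membership test for $\sigma_{kj}\pi_i$ in $\Gamma(k)$, with respect to the data structure on termination, which computes $\sigma_{kj}\pi_i\sigma_{kj_k}^-\sigma_{k-1,j_{k-1}}^-\cdots$. Then $j_l$ is defined for every input, and $$\Pr(j_l=l)<\frac1l+\frac{l^2}{k^2};$$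 the same bound holds for the conditional probability when $\pi_2,\dots,\pi_l$ are given arbitrary fixed values and only the remaining generators are random; (c) there is a constant $c>0$ such that for every $n\geq 0$ some input $(\pi_2,\dots,\pi_n)$ makes the computation perform at least $c\,n^5$ steps. -/

import Mathlib

/-! Perms are permutations of `ℕ`; the points of interest are the positive integers.
Products are read from left to right: `αβ` (first `α`, then `β`) is `α.trans β`, and the inverse
`α⁻` is `α.symm`. -/

namespace PermAlg

open Equiv

/-- `Π(k)`: the perms of the positive integers that fix all points `> k`
(the additional point `0` of `ℕ` is fixed as well). -/
def MemPi (k : ℕ) (π : Perm ℕ) : Prop := ∀ a, ¬ (1 ≤ a ∧ a ≤ k) → π a = a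

/-- The data structure together with a clock that counts elementary steps.
* `slot k j` is `σ_{kj}`, with `none` for the empty slot;
* `idx k` is the linear list of the `j` with `σ_{kj} ≠ ∅`, in the order of their creation;
* `gens k` is the linear list of the elements of `T(k)`, in the order of their insertion. -/
structure State where
  slot : ℕ → ℕ → Option (Perm ℕ)
  idx : ℕ → List ℕ
  gens : ℕ → List (Perm ℕ)
  clock : ℕ

/-- Let `c` elementary steps pass. -/
def State.tick (M : State) (c : ℕ) : State := { M with clock := M.clock + c }

/-- Append `π` to `T(k)`. -/
def State.addGen (M : State) (k : ℕ) (π : Perm ℕ) : State :=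
  { M with gens := Function.update M.gens k (M.gens k ++ [π]) }

/-- The assignment `σ_{kj} ← π` for an empty slot. -/
def State.setSlot (M : State) (k j : ℕ) (π : Perm ℕ) : State :=
  { M with
    slot := Function.update M.slot k (Function.update (M.slot k) j (some π))
    idx := Function.update M.idx k (M.idx k ++ [j]) }

/-- The initial data structure for degree `n`: `σ_{kk}` is the identity, all other slots and all
`T(k)` are empty. One step is charged for each of the slots `σ_{kj}`, `1 ≤ j ≤ k ≤ n`. -/
def State.init (n : ℕ) : State where
  slot k j := if j = k then some 1 else none
  idx k := [k]
  gens _ := []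
  clock := ∑ k ∈ Finset.Icc 1 n, k

/-- The membership test `π ∈ Γ(k)`, with the number of elementary steps that it takes.
Let `π` take `k ↦ j`. If `σ_{kj} = ∅` the answer is no; otherwise the test continues with
`π σ_{kj}⁻` and `Γ(k-1)`. Each level costs one step, and the multiplication at level `k` costs `k`
more steps, unless `j = k` (when `σ_{kk}` is the identity and nothing has to be multiplied). -/
def memberTest (M : State) : ℕ → Perm ℕ → Bool × ℕ
  | 0, _ => (true, 0)
  | k + 1, π =>
    let j := π (k + 1)
    match M.slot (k + 1) j with
    | none => (false, 1)
    | some s =>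
      let r := memberTest M k (π.trans s.symm)
      (r.1, r.2 + 1 + if j = k + 1 then 0 else k + 1)

/-- The index `j_l` in the membership test for `π ∈ Γ(k)`, which forms the products
`π σ_{k j_k}⁻ σ_{k-1, j_{k-1}}⁻ ⋯`: the point to which the product that is present when level `l`
is reached takes `l`. It is `none` if the test does not reach level `l`. -/
def siftIndex (M : State) : ℕ → Perm ℕ → ℕ → Option ℕ
  | 0, _, _ => none
  | k + 1, π, l =>
    if l = k + 1 then some (π (k + 1))
    else (M.slot (k + 1) (π (k + 1))).bind fun s => siftIndex M k (π.trans s.symm) l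

/-- The index `j_l` in the membership test for `σ_{kj} τ ∈ Γ(k)`. -/
def testIndex (M : State) (k j : ℕ) (τ : Perm ℕ) (l : ℕ) : Option ℕ :=
  (M.slot k j).bind fun s => siftIndex M k (s.trans τ) l

/-- The procedure calls `A_k(π)` and `B_k(π)`. -/
inductive Call where
  | A (k : ℕ) (π : Perm ℕ)
  | B (k : ℕ) (π : Perm ℕ)

/-- The two mutually recursive procedures, in the recursive implementation of step A2, run with
nesting depth of the calls at most `d`. The value is the state on return; it is `none` if the
depth `d` is exceeded. (So a call terminates iff the value is not `none` for all large `d`, and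
then the value no longer depends on `d`. The bound `d` has no influence on the steps counted.)

`A_k(π)`: insert `π` into `T(k)`; perform `B_k(σπ)` for all `σ` in the current set `Σ(k)`.

`B_k(π)`: let `π` take `k ↦ j`. If `σ_{kj} = ∅`, set `σ_{kj} ← π`, perform `B_k(πτ)` for all `τ`
in the current set `T(k)`, and terminate. If `π σ_{kj}⁻ ∈ Γ(k-1)`, terminate. Otherwise perform
`A_{k-1}(π σ_{kj}⁻)`.

Steps: a product of two perms of `Π(k)` takes `k` steps (none if the second factor is
`σ_{kk}⁻`), the assignment `σ_{kj} ← π` takes `k` steps, the insertion of a pointer into `T(k)`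
takes one step, and so does finding `j` and inspecting `σ_{kj}`. -/
def exec : ℕ → Call → State → Option State
  | 0, _, _ => none
  | d + 1, .A k π, M =>
    let M₁ := (M.addGen k π).tick 1
    (M₁.idx k).foldlM (init := M₁) fun N j =>
      match N.slot k j with
      | none => some N
      | some s => exec d (.B k (s.trans π)) (N.tick k)
  | d + 1, .B k π, M =>
    let j := π k
    match M.slot k j with
    | none =>
      let M₁ := (M.setSlot k j π).tick (1 + k)
      (M₁.gens k).foldlM (init := M₁) fun N τ => exec d (.B k (π.trans τ)) (N.tick k)
    | some s =>
      let ρ := π.trans s.symm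
      let r := memberTest M (k - 1) ρ
      let M₁ := M.tick (1 + (if j = k then 0 else k) + r.2)
      if r.1 then some M₁ else exec d (.A (k - 1) ρ) M₁

/-- The possible choices of `π_k`: the perms in `Π(k)` that take `k ↦ k - 1`. -/
def Gen (k : ℕ) : Type := {π : Perm ℕ // MemPi k π ∧ π k = k - 1}

instance (k : ℕ) : Finite (Gen k) := by
  have h : Finite {f : Perm ℕ // ∀ a, ¬ (1 ≤ a ∧ a ≤ k) → f a = a} := by
    have : Finite {a : ℕ // 1 ≤ a ∧ a ≤ k} := (Set.finite_Icc 1 k).to_subtype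
    exact Finite.of_equiv _ (Perm.subtypeEquivSubtypePerm (fun a : ℕ => 1 ≤ a ∧ a ≤ k))
  exact Finite.of_injective
    (fun g : Gen k => (⟨g.1, g.2.1⟩ : {f : Perm ℕ // ∀ a, ¬ (1 ≤ a ∧ a ≤ k) → f a = a}))
    (fun g h e => Subtype.ext (congrArg (fun f => f.1) e))

noncomputable instance (k : ℕ) : Fintype (Gen k) := Fintype.ofFinite _

/-- The inputs `(π_2, …, π_n)`; the `1! 2! ⋯ (n-1)!` elements are equally likely. -/
abbrev Input (n : ℕ) : Type := ∀ k : Finset.Icc 2 n, Gen k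

/-- The perm `π_k` of an input, for `2 ≤ k ≤ n` (and the identity for other `k`). -/
def Input.perm {n : ℕ} (x : Input n) (k : ℕ) : Perm ℕ :=
  if h : k ∈ Finset.Icc 2 n then (x ⟨k, h⟩).1 else 1

/-- The whole computation for degree `n`: the generators `π_2, …, π_n` are input in this order.
Each is read (`n` steps) and tested for membership in `Γ(n)`, and `A_n` is performed if the test
fails. The calls of `A_n` are run with nesting depth at most `d`. -/
def run {n : ℕ} (d : ℕ) (x : Input n) : Option State :=
  ((List.range' 2 (n - 1)).map (Input.perm x)).foldlM (init := State.init n) fun M π =>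
    let r := memberTest M n π
    let M₁ := M.tick (n + r.2)
    if r.1 then some M₁ else exec d (.A n π) M₁

open Classical in
/-- The probability of the event `E` given the event `F`, for a uniformly random input. -/
noncomputable def condProb {n : ℕ} (E F : Input n → Prop) : ℝ :=
  ((Finset.univ.filter fun x => E x ∧ F x).card : ℝ) / (Finset.univ.filter F).card

/-- The average of `f` over all inputs. -/
noncomputable def average {n : ℕ} (f : Input n → ℝ) : ℝ :=
  (∑ x, f x) / Fintype.card (Input n)

end PermAlg

namespace PermAlg

open Equiv

/-! ### The groups `Π(k)` -/

/-! Termination and the upper bound hold because the course of the computation does not depend on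
the input. When π_k is read, the levels below k are complete, with σ_{mj} = π_m π_{m-1} ⋯ π_{j+1}
(`Full`), and the levels from k on hold only identities (`Waiting`). As π_k fixes all points above
k, the call A_n(π_k) falls through to A_k(π_k). There a product σ_{kj}π_i stays in slot j if i < j,
opens slot j-1 if i = j, and finds the level already full if i > j (`exists_runs_B`). So level k
causes O(k²) tests of O(k²) steps each, hence O(n⁵) steps for every input.

For the lower bound, consider the tests of ρ = σ_{kj}π_iσ_{kj}⁻ with 1 < i < j < k; level l costs l
steps unless j_l = l. This event is split in two. If ρ ∉ Π(l), let m > l be the largest point moved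
by ρ. Changing π_m, and compensating in π_k so that σ_{kj} and ρ survive, multiplies the residue at
level l by any transposition (l t); hence l disjoint events are equally likely, which gives 1/l
(`mul_card_fixed_le`). If ρ ∈ Π(l) fixes l, the test divides by identities only down to level l, and
ρ moves both iσ_{kj}⁻ and (i-1)σ_{kj}⁻, which must then be < l. These form a uniformly random pair
of distinct points < k, which gives (l-1)(l-2)/((k-1)(k-2)) < l²/k² (`mul_card_memPi_le`). Both
arguments leave π_2, …, π_l alone, so they hold conditionally as well. Summing over a box of
quadruples (k, j, i, l) gives an average of order n⁵, and some input is at least average.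

In the code αβ is `β * α`, so factors appear in reverse order. -/

lemma MemPi.one (k : ℕ) : MemPi k 1 := fun _ _ => rfl

lemma MemPi.mul {k : ℕ} {π τ : Perm ℕ} (hπ : MemPi k π) (hτ : MemPi k τ) : MemPi k (π * τ) :=
  fun a ha => by rw [Perm.mul_apply, hτ a ha, hπ a ha]

lemma MemPi.inv {k : ℕ} {π : Perm ℕ} (hπ : MemPi k π) : MemPi k π⁻¹ :=
  fun a ha => by rw [Perm.inv_eq_iff_eq, hπ a ha]

lemma MemPi.mono {k m : ℕ} {π : Perm ℕ} (hπ : MemPi k π) (h : k ≤ m) : MemPi m π :=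
  fun a ha => hπ a (by omega)

lemma MemPi.apply_of_lt {k a : ℕ} {π : Perm ℕ} (hπ : MemPi k π) (h : k < a) : π a = a :=
  hπ a (by omega)

lemma MemPi.apply_mem {k a : ℕ} {π : Perm ℕ} (hπ : MemPi k π) (ha : 1 ≤ a ∧ a ≤ k) :
    1 ≤ π a ∧ π a ≤ k := by
  by_contra h
  exact h (by rw [π.injective (hπ _ h)]; exact ha)

lemma MemPi.of_succ {k : ℕ} {π : Perm ℕ} (hπ : MemPi (k + 1) π) (h : π (k + 1) = k + 1) :
    MemPi k π := fun a ha => by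
  by_cases e : a = k + 1
  · rw [e, h]
  · exact hπ a (by omega)

lemma memPi_swap {k a b : ℕ} (ha : 1 ≤ a ∧ a ≤ k) (hb : 1 ≤ b ∧ b ≤ k) : MemPi k (swap a b) :=
  fun c hc => swap_apply_of_ne_of_ne (by rintro rfl; exact hc ha) (by rintro rfl; exact hc hb)

/-- `p 2, …, p n` are possible generators `π_2, …, π_n`. -/
def IsGenFamily (p : ℕ → Perm ℕ) (n : ℕ) : Prop :=
  ∀ k, 2 ≤ k → k ≤ n → MemPi k (p k) ∧ p k k = k - 1

/-! ### The transversals on termination -/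

/-- The product `π_k π_{k-1} ⋯ π_{j+1}` (from left to right), which is the identity for `j ≥ k`. -/
def transversal (p : ℕ → Perm ℕ) : ℕ → ℕ → Perm ℕ
  | 0, _ => 1
  | k + 1, j => if k + 1 ≤ j then 1 else transversal p k j * p (k + 1)

variable {p : ℕ → Perm ℕ} {n : ℕ}

lemma transversal_of_le {k j : ℕ} (h : k ≤ j) : transversal p k j = 1 := by
  cases k with
  | zero => rfl
  | succ k => simp [transversal, h]

lemma transversal_succ {k j : ℕ} (h : j ≤ k) :
    transversal p (k + 1) j = transversal p k j * p (k + 1) :=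
  if_neg (by omega)

lemma mul_transversal_succ {k j : ℕ} (h : j < k) :
    p (j + 1) * transversal p k (j + 1) = transversal p k j := by
  induction k with
  | zero => omega
  | succ k ih =>
    rcases Nat.lt_or_ge j k with h' | h'
    · rw [transversal_succ h', transversal_succ h'.le, ← mul_assoc, ih h']
    · obtain rfl : j = k := by omega
      rw [transversal_of_le le_rfl, transversal_succ le_rfl, transversal_of_le le_rfl]
      simp

lemma transversal_congr {q : ℕ → Perm ℕ} {k j : ℕ} (h : ∀ m, j < m → m ≤ k → p m = q m) :
    transversal p k j = transversal q k j := by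
  induction k with
  | zero => rfl
  | succ k ih =>
    rcases Nat.lt_or_ge k j with hj | hj
    · rw [transversal_of_le hj, transversal_of_le hj]
    · rw [transversal_succ hj, transversal_succ hj, h (k + 1) (by omega) le_rfl,
        ih fun m h1 h2 => h m h1 (by omega)]

lemma transversal_mem (hp : IsGenFamily p n) {k j : ℕ} (hk : k ≤ n) (hj : 1 ≤ j) :
    MemPi k (transversal p k j) := by
  induction k with
  | zero => exact MemPi.one 0
  | succ k ih =>
    rcases Nat.lt_or_ge k j with h | h
    · rw [transversal_of_le h]; exact MemPi.one _
    · rw [transversal_succ h]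
      exact ((ih (by omega)).mono (by omega)).mul (hp (k + 1) (by omega) hk).1

lemma transversal_apply (hp : IsGenFamily p n) {k j : ℕ} (hk : k ≤ n) (hj : 1 ≤ j)
    (hjk : j ≤ k) : transversal p k j k = j := by
  induction k with
  | zero => omega
  | succ k ih =>
    rcases Nat.lt_or_ge k j with h | h
    · rw [transversal_of_le h, Perm.one_apply]; omega
    · rw [transversal_succ h, Perm.mul_apply, (hp (k + 1) (by omega) hk).2, Nat.add_sub_cancel,
        ih (by omega) h]

lemma transversal_inv_mul_mem (hp : IsGenFamily p n) {k : ℕ} (hk : k + 1 ≤ n) {ρ : Perm ℕ}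
    (hρ : MemPi (k + 1) ρ) : MemPi k ((transversal p (k + 1) (ρ (k + 1)))⁻¹ * ρ) := by
  have h := hρ.apply_mem (a := k + 1) (by omega)
  refine MemPi.of_succ ((transversal_mem hp hk h.1).inv.mul hρ) ?_
  rw [Perm.mul_apply, Perm.inv_eq_iff_eq, transversal_apply hp hk h.1 h.2]

/-! ### Sifting through full transversals -/

/-- The product that is present when the membership test for `ρ ∈ Γ(k)` reaches level `l`. -/
def residue (p : ℕ → Perm ℕ) : ℕ → ℕ → Perm ℕ → Perm ℕ
  | 0, _, ρ => ρ
  | k + 1, l, ρ =>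
    if k + 1 ≤ l then ρ else residue p k l ((transversal p (k + 1) (ρ (k + 1)))⁻¹ * ρ)

lemma residue_of_le {k l : ℕ} (h : k ≤ l) (ρ : Perm ℕ) : residue p k l ρ = ρ := by
  cases k with
  | zero => rfl
  | succ k => simp [residue, h]

lemma residue_succ {k l : ℕ} (h : l ≤ k) (ρ : Perm ℕ) :
    residue p (k + 1) l ρ = residue p k l ((transversal p (k + 1) (ρ (k + 1)))⁻¹ * ρ) :=
  if_neg (by omega)

/-- A factor from Π(l) does not affect the images of points above l, so the test divides by the same
slots and the factor survives on the side away from the divisions. -/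
lemma residue_mul {k l : ℕ} {ρ θ : Perm ℕ} (hθ : MemPi l θ) :
    residue p k l (ρ * θ) = residue p k l ρ * θ := by
  induction k generalizing ρ with
  | zero => rfl
  | succ k ih =>
    rcases Nat.lt_or_ge k l with h | h
    · rw [residue_of_le h, residue_of_le h]
    · rw [residue_succ h, residue_succ h, ← ih, Perm.mul_apply, hθ.apply_of_lt (by omega),
        mul_assoc]

lemma residue_congr {q : ℕ → Perm ℕ} {k l : ℕ} (h : ∀ m, m ≤ k → p m = q m) (ρ : Perm ℕ) :
    residue p k l ρ = residue q k l ρ := by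
  induction k generalizing ρ with
  | zero => rfl
  | succ k ih =>
    rcases Nat.lt_or_ge k l with h' | h'
    · rw [residue_of_le h', residue_of_le h']
    · rw [residue_succ h', residue_succ h', ih fun m hm => h m (by omega),
        transversal_congr fun m _ => h m]

/-- At the levels above m only the identities σ_{aa} are divided out. -/
lemma residue_of_mem {k l m : ℕ} {ρ : Perm ℕ} (hρ : MemPi m ρ) (hm : m ≤ k) (hl : l ≤ m) :
    residue p k l ρ = residue p m l ρ := by
  induction k with
  | zero => obtain rfl : m = 0 := by omega
            rfl
  | succ k ih =>
    rcases Nat.lt_or_ge k m with h | h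
    · obtain rfl : m = k + 1 := by omega
      rfl
    · rw [residue_succ (hl.trans h), hρ.apply_of_lt (by omega), transversal_of_le le_rfl, inv_one,
        one_mul, ih h]

/-- The number of steps of a successful membership test for `ρ ∈ Γ(k)`. -/
def testCost (p : ℕ → Perm ℕ) (k : ℕ) (ρ : Perm ℕ) : ℕ :=
  ∑ l ∈ Finset.Icc 1 k, (1 + if residue p k l ρ l = l then 0 else l)

lemma testCost_succ (k : ℕ) (ρ : Perm ℕ) :
    testCost p (k + 1) ρ = testCost p k ((transversal p (k + 1) (ρ (k + 1)))⁻¹ * ρ) + 1 +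
      if ρ (k + 1) = k + 1 then 0 else k + 1 := by
  rw [testCost, Finset.sum_Icc_succ_top (by omega), residue_of_le le_rfl, testCost, ← add_assoc]
  congr 2
  refine Finset.sum_congr rfl fun l hl => ?_
  rw [residue_succ (Finset.mem_Icc.1 hl).2]

/-- All slots `σ_{mj}` with `m ≤ k` are filled, with the products `π_m π_{m-1} ⋯ π_{j+1}`. -/
def Full (p : ℕ → Perm ℕ) (k : ℕ) (M : State) : Prop :=
  ∀ m j, 1 ≤ j → j ≤ m → m ≤ k → M.slot m j = some (transversal p m j)

lemma Full.mono {k m : ℕ} {M : State} (h : Full p k M) (hm : m ≤ k) : Full p m M :=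
  fun a j h1 h2 h3 => h a j h1 h2 (h3.trans hm)

lemma memberTest_of_full (hp : IsGenFamily p n) {M : State} {k : ℕ} (hM : Full p k M)
    (hk : k ≤ n) {ρ : Perm ℕ} (hρ : MemPi k ρ) : memberTest M k ρ = (true, testCost p k ρ) := by
  induction k generalizing ρ with
  | zero => simp [memberTest, testCost]
  | succ k ih =>
    have h := hρ.apply_mem (a := k + 1) (by omega)
    have := ih (hM.mono (by omega)) (by omega) (transversal_inv_mul_mem hp hk hρ)
    rw [testCost_succ, memberTest]
    simp only [hM _ _ h.1 h.2 le_rfl]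
    change ((memberTest M k ((transversal p (k + 1) (ρ (k + 1)))⁻¹ * ρ)).1, _) = _
    rw [show ρ.trans (transversal p (k + 1) (ρ (k + 1))).symm =
      (transversal p (k + 1) (ρ (k + 1)))⁻¹ * ρ from rfl, this]

lemma siftIndex_of_full (hp : IsGenFamily p n) {M : State} {k l : ℕ} (hM : Full p k M)
    (hk : k ≤ n) (h1 : 1 ≤ l) (hl : l ≤ k) {ρ : Perm ℕ} (hρ : MemPi k ρ) :
    siftIndex M k ρ l = some (residue p k l ρ l) := by
  induction k generalizing ρ with
  | zero => omega
  | succ k ih =>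
    have h := hρ.apply_mem (a := k + 1) (by omega)
    rw [siftIndex]
    split_ifs with e
    · rw [e, residue_of_le le_rfl]
    · rw [hM _ _ h.1 h.2 le_rfl, residue_succ (by omega)]
      exact ih (hM.mono (by omega)) (by omega) (by omega) (transversal_inv_mul_mem hp hk hρ)

lemma memberTest_cost_le (M : State) (k : ℕ) (ρ : Perm ℕ) :
    (memberTest M k ρ).2 ≤ k * (k + 1) := by
  induction k generalizing ρ with
  | zero => simp [memberTest]
  | succ k ih =>
    rw [memberTest]
    dsimp only
    split
    · dsimp only; nlinarith
    · rename_i s _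
      have := ih (ρ.trans s.symm)
      dsimp only
      split_ifs <;> nlinarith

/-! ### Terminating calls -/

/-- The call `c` terminates and leads from the state `M` to the state `N`. -/
def Runs (c : Call) (M N : State) : Prop := ∃ D, ∀ d, D ≤ d → exec d c M = some N

/-- The calls `B_k(πτ)` for the `τ` in the list `T` terminate and lead from `M` to `N`. -/
def RunsFold (k : ℕ) (π : Perm ℕ) (T : List (Perm ℕ)) (M N : State) : Prop :=
  ∃ D, ∀ d, D ≤ d →
    T.foldlM (init := M) (fun N τ => exec d (.B k (π.trans τ)) (N.tick k)) = some N

lemma RunsFold.nil (k : ℕ) (π : Perm ℕ) (M : State) : RunsFold k π [] M M := ⟨0, fun _ _ => rfl⟩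

lemma RunsFold.cons {k : ℕ} {π τ : Perm ℕ} {T : List (Perm ℕ)} {M N N' : State}
    (h : Runs (.B k (τ * π)) (M.tick k) N) (h' : RunsFold k π T N N') :
    RunsFold k π (τ :: T) M N' := by
  obtain ⟨D, hD⟩ := h
  obtain ⟨D', hD'⟩ := h'
  refine ⟨max D D', fun d hd => ?_⟩
  have h1 := hD d ((le_max_left _ _).trans hd)
  rw [List.foldlM_cons, show π.trans τ = τ * π from rfl, h1]
  exact hD' d ((le_max_right _ _).trans hd)

lemma RunsFold.append {k : ℕ} {π : Perm ℕ} {T T' : List (Perm ℕ)} {M N N' : State}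
    (h : RunsFold k π T M N) (h' : RunsFold k π T' N N') : RunsFold k π (T ++ T') M N' := by
  obtain ⟨D, hD⟩ := h
  obtain ⟨D', hD'⟩ := h'
  refine ⟨max D D', fun d hd => ?_⟩
  rw [List.foldlM_append, hD d ((le_max_left _ _).trans hd)]
  exact hD' d ((le_max_right _ _).trans hd)

lemma runs_B_pass {M : State} {k c : ℕ} {π s : Perm ℕ} (hs : M.slot k (π k) = some s)
    (h : memberTest M (k - 1) (s⁻¹ * π) = (true, c)) :
    Runs (.B k π) M (M.tick (1 + (if π k = k then 0 else k) + c)) := by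
  refine ⟨1, fun d hd => ?_⟩
  obtain ⟨d, rfl⟩ := Nat.exists_eq_add_of_le' hd
  rw [exec]
  simp only [hs]
  rw [show π.trans s.symm = s⁻¹ * π from rfl, h]
  rfl

lemma runs_B_fail {M N : State} {k c : ℕ} {π s : Perm ℕ} (hs : M.slot k (π k) = some s)
    (h : memberTest M (k - 1) (s⁻¹ * π) = (false, c))
    (hN : Runs (.A (k - 1) (s⁻¹ * π)) (M.tick (1 + (if π k = k then 0 else k) + c)) N) :
    Runs (.B k π) M N := by
  obtain ⟨D, hD⟩ := hN
  refine ⟨D + 1, fun d hd => ?_⟩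
  obtain ⟨d, rfl⟩ := Nat.exists_eq_add_of_le' (show 1 ≤ d by omega)
  rw [exec]
  simp only [hs]
  rw [show π.trans s.symm = s⁻¹ * π from rfl, h]
  exact hD d (by omega)

lemma runs_B_new {M N : State} {k : ℕ} {π : Perm ℕ} (hs : M.slot k (π k) = none)
    (hN : RunsFold k π (M.gens k) ((M.setSlot k (π k) π).tick (1 + k)) N) :
    Runs (.B k π) M N := by
  obtain ⟨D, hD⟩ := hN
  refine ⟨D + 1, fun d hd => ?_⟩
  obtain ⟨d, rfl⟩ := Nat.exists_eq_add_of_le' (show 1 ≤ d by omega)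
  rw [exec]
  simp only [hs]
  exact hD d (by omega)

/-- While Σ(k) contains only the identity, A_k(π) amounts to the single call B_k(π). Every call of A
that occurs is of this kind. -/
lemma runs_A_of_idx {M N : State} {k : ℕ} {π : Perm ℕ} (hi : M.idx k = [k])
    (hs : M.slot k k = some 1) (hN : Runs (.B k π) (((M.addGen k π).tick 1).tick k) N) :
    Runs (.A k π) M N := by
  obtain ⟨D, hD⟩ := hN
  refine ⟨D + 1, fun d hd => ?_⟩
  obtain ⟨d, rfl⟩ := Nat.exists_eq_add_of_le' (show 1 ≤ d by omega)
  rw [exec]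
  have h1 : ((M.addGen k π).tick 1).idx k = [k] := hi
  have h2 : ((M.addGen k π).tick 1).slot k k = some 1 := hs
  simp only [h1, List.foldlM_cons, List.foldlM_nil, h2]
  rw [show (1 : Perm ℕ).trans π = π from rfl, hD d (by omega)]
  rfl

/-! ### Filling the slots of one level -/

lemma Full.tick {k : ℕ} {M : State} (h : Full p k M) (c : ℕ) : Full p k (M.tick c) := h

/-- The conjugate `σ_{kj} π_i σ_{kj}⁻`. -/
def conjugate (p : ℕ → Perm ℕ) (k j i : ℕ) : Perm ℕ :=
  (transversal p k j)⁻¹ * p i * transversal p k j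

/-- The number of steps of the test `σ_{kj} π_i σ_{kj}⁻ ∈ Γ(k-1)`. -/
def conjCost (p : ℕ → Perm ℕ) (k j i : ℕ) : ℕ := testCost p (k - 1) (conjugate p k j i)

lemma State.tick_tick (M : State) (a b : ℕ) : (M.tick a).tick b = M.tick (a + b) := by
  simp [State.tick, add_assoc]

/-- When all slots that are hit are filled and the levels below are full, only the clock changes.
The bound 3k² covers one product, one division and a test of at most (k-1)k steps. -/
lemma runsFold_pass (hp : IsGenFamily p n) {k : ℕ} (h1 : 1 ≤ k) (hk : k ≤ n) {π : Perm ℕ}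
    {M : State} (hM : Full p (k - 1) M) (T : List (Perm ℕ))
    (hT : ∀ τ ∈ T, MemPi k (τ * π) ∧
      M.slot k ((τ * π) k) = some (transversal p k ((τ * π) k))) :
    ∃ c, RunsFold k π T M (M.tick c) ∧ c ≤ T.length * (3 * k ^ 2) ∧
      (T.map fun τ =>
        testCost p (k - 1) ((transversal p k ((τ * π) k))⁻¹ * (τ * π))).sum ≤ c := by
  induction T generalizing M with
  | nil => exact ⟨0, RunsFold.nil _ _ _, by simp, by simp⟩
  | cons τ T ih =>
    obtain ⟨hm, hs⟩ := hT τ (by simp)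
    obtain ⟨k, rfl⟩ := Nat.exists_eq_add_of_le' h1
    have ht := memberTest_of_full hp (Full.tick (k := k) hM (k + 1)) (by omega : k ≤ n)
      (transversal_inv_mul_mem hp hk hm)
    have hc := memberTest_cost_le (M.tick (k + 1)) k
      ((transversal p (k + 1) ((τ * π) (k + 1)))⁻¹ * (τ * π))
    rw [ht] at hc
    have hr := runs_B_pass (M := M.tick (k + 1)) hs ht
    rw [State.tick_tick] at hr
    set a := k + 1 + (1 + (if (τ * π) (k + 1) = k + 1 then 0 else k + 1) +
      testCost p k ((transversal p (k + 1) ((τ * π) (k + 1)))⁻¹ * (τ * π))) with ha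
    obtain ⟨c, hr', hc1, hc2⟩ := ih (hM.tick a) fun τ' h' => hT τ' (by simp [h'])
    rw [State.tick_tick] at hr'
    refine ⟨a + c, RunsFold.cons hr hr', ?_, ?_⟩
    · have : a ≤ 3 * (k + 1) ^ 2 := by
        dsimp only at hc
        rw [ha]
        split_ifs <;> nlinarith
      rw [List.length_cons]
      linarith
    · rw [List.map_cons, List.sum_cons]
      simp only [Nat.add_sub_cancel] at hc2 ⊢
      omega

lemma sum_map_range' (f : ℕ → ℕ) (a b : ℕ) :
    ((List.range' a (b - a)).map f).sum = ∑ i ∈ Finset.Ico a b, f i := by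
  rfl

/-- The generators `π_2, …, π_{k-1}`. -/
def gensBelow (p : ℕ → Perm ℕ) (k : ℕ) : List (Perm ℕ) := (List.range' 2 (k - 2)).map p

lemma gensBelow_succ {k : ℕ} (h : 2 ≤ k) : gensBelow p (k + 1) = gensBelow p k ++ [p k] := by
  obtain ⟨k, rfl⟩ := Nat.exists_eq_add_of_le' h
  rw [gensBelow, show k + 2 + 1 - 2 = k + 1 by omega, List.range'_concat]
  simp [gensBelow, add_comm]

lemma gensBelow_split {j k : ℕ} (h : 2 ≤ j) (hk : j < k) :
    gensBelow p k = gensBelow p j ++ (p j :: (List.range' (j + 1) (k - (j + 1))).map p) := by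
  have : List.range' 2 (k - 2) =
      List.range' 2 (j - 2) ++ (j :: List.range' (j + 1) (k - (j + 1))) := by
    rw [← List.range'_succ, show k - 2 = (j - 2) + (k - (j + 1) + 1) by omega,
      ← List.range'_append]
    congr 2; omega
  rw [gensBelow, this, List.map_append, List.map_cons, gensBelow]

lemma mem_gensBelow {k : ℕ} {τ : Perm ℕ} : τ ∈ gensBelow p k ↔ ∃ i, (2 ≤ i ∧ i < k) ∧ p i = τ := by
  simp only [gensBelow, List.mem_map, List.mem_range'_1]
  constructor <;> rintro ⟨i, h, rfl⟩ <;> exact ⟨i, by omega, rfl⟩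

lemma length_gensBelow (k : ℕ) : (gensBelow p k).length = k - 2 := by simp [gensBelow]

/-- The call `B_k(σ_{kj})`, at a time when the slots `σ_{kk}, …, σ_{k,j+1}` are filled, fills all
slots of level `k`. -/
lemma exists_runs_B (hp : IsGenFamily p n) {k : ℕ} (hk : k ≤ n) {j : ℕ} (hj : 1 ≤ j)
    (hjk : j < k) {M : State} (hM : Full p (k - 1) M)
    (hs : ∀ i, M.slot k i = if j < i ∧ i ≤ k then some (transversal p k i) else none)
    (hg : M.gens k = gensBelow p (k + 1)) :
    ∃ N, Runs (.B k (transversal p k j)) M N ∧ Full p k N ∧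
      (∀ m, m ≠ k → N.slot m = M.slot m ∧ N.idx m = M.idx m) ∧ N.gens = M.gens ∧
      N.clock ≤ M.clock + j * (6 * k ^ 3) ∧
      M.clock + ∑ j' ∈ Finset.Icc 1 j, ∑ i ∈ Finset.Ico 2 j', conjCost p k j' i ≤ N.clock := by
  induction j, hj using Nat.le_induction generalizing M with
  | base =>
    have ha := transversal_apply hp hk le_rfl hjk.le
    set M₁ := (M.setSlot k 1 (transversal p k 1)).tick (1 + k) with hM₁
    have hs₁ : ∀ i, 1 ≤ i → i ≤ k → M₁.slot k i = some (transversal p k i) := fun i h1 h2 => by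
      rcases eq_or_ne i 1 with rfl | h
      · simp [hM₁, State.tick, State.setSlot]
      · simp only [hM₁, State.tick, State.setSlot, Function.update_self, ne_eq, h,
          not_false_eq_true, Function.update_of_ne, hs]
        rw [if_pos (by omega)]
    have hf₁ : Full p (k - 1) M₁ := fun m i h1 h2 h3 => by
      have : m ≠ k := by omega
      simp only [hM₁, State.tick, State.setSlot, Function.update_of_ne this]
      exact hM m i h1 h2 h3
    -- Slot 1 was the last empty one of level k, so all products σ_{k1}π_i pass.
    obtain ⟨c, hr, hc, -⟩ := runsFold_pass hp (by omega) hk hf₁ (π := transversal p k 1)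
      (gensBelow p (k + 1)) fun τ hτ => by
        obtain ⟨i, hi, rfl⟩ := mem_gensBelow.1 hτ
        have hm := ((hp i hi.1 (by omega)).1.mono (by omega)).mul
          (transversal_mem hp hk (le_refl 1))
        have := hm.apply_mem (a := k) (by omega)
        exact ⟨hm, hs₁ _ this.1 this.2⟩
    refine ⟨M₁.tick c, runs_B_new (by rw [ha, hs, if_neg (by omega)]) ?_, ?_, ?_, rfl, ?_, ?_⟩
    · rw [ha, hg]; exact hr
    · intro m i h1 h2 h3
      rcases eq_or_ne m k with rfl | h
      · exact hs₁ i h1 h2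
      · exact hf₁ m i h1 h2 (by omega)
    · intro m hm
      simp [hM₁, State.tick, State.setSlot, hm]
    · rw [length_gensBelow] at hc
      change M.clock + (1 + k) + c ≤ _
      have : (k + 1 - 2) * (3 * k ^ 2) ≤ k * (3 * k ^ 2) := Nat.mul_le_mul_right _ (by omega)
      nlinarith [Nat.pow_le_pow_left (show 2 ≤ k by omega) 2]
    · simp only [Finset.Icc_self, Finset.sum_singleton]
      rw [Finset.Ico_eq_empty (by omega), Finset.sum_empty]
      change _ ≤ M.clock + (1 + k) + c
      omega
  | succ j hj ih =>
    have ha := transversal_apply hp hk (by omega : 1 ≤ j + 1) hjk.le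
    set M₁ := (M.setSlot k (j + 1) (transversal p k (j + 1))).tick (1 + k) with hM₁
    have hs₁ : ∀ i, M₁.slot k i = if j < i ∧ i ≤ k then some (transversal p k i) else none := by
      intro i
      rcases eq_or_ne i (j + 1) with rfl | h
      · simp [hM₁, State.tick, State.setSlot, hjk.le]
      · simp only [hM₁, State.tick, State.setSlot, Function.update_self, ne_eq, h,
          not_false_eq_true, Function.update_of_ne, hs]
        congr 1
        exact propext (by omega)
    have hf₁ : Full p (k - 1) M₁ := fun m i h1 h2 h3 => by
      have : m ≠ k := by omega
      simp only [hM₁, State.tick, State.setSlot, Function.update_of_ne this]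
      exact hM m i h1 h2 h3
    have hmem : ∀ i, 2 ≤ i → i ≤ k → MemPi k (p i * transversal p k (j + 1)) := fun i h2 h3 =>
      ((hp i h2 (by omega)).1.mono h3).mul (transversal_mem hp hk (by omega))
    -- Since π_i fixes j+1, the product falls into the slot just filled, and the element tested is
    -- the conjugate of π_i.
    have hfix : ∀ i, 2 ≤ i → i < j + 1 → (p i * transversal p k (j + 1)) k = j + 1 :=
      fun i h2 h3 => by
        rw [Perm.mul_apply, ha, (hp i h2 (by omega)).1.apply_of_lt h3]
    obtain ⟨c, hr, hc, hc'⟩ := runsFold_pass hp (by omega) hk hf₁ (π := transversal p k (j + 1))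
      (gensBelow p (j + 1)) fun τ hτ => by
        obtain ⟨i, hi, rfl⟩ := mem_gensBelow.1 hτ
        refine ⟨hmem i hi.1 (by omega), ?_⟩
        rw [hfix i hi.1 hi.2, hs₁, if_pos (by omega)]
    rw [gensBelow, List.map_map, show j + 1 - 2 = (j + 1) - 2 from rfl, sum_map_range'] at hc'
    have hc'' : ∑ i ∈ Finset.Ico 2 (j + 1), conjCost p k (j + 1) i ≤ c := by
      refine le_of_eq_of_le (Finset.sum_congr rfl fun i hi => ?_) hc'
      rw [Finset.mem_Ico] at hi
      simp only [Function.comp, hfix i hi.1 hi.2, conjCost, conjugate, mul_assoc]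
    -- The next generator is π_{j+1}, and σ_{k,j+1}π_{j+1} = σ_{kj} meets an empty slot: this nested
    -- call fills the rest of the level, so the remaining generators pass.
    obtain ⟨N, hN, hfull, hframe, hgens, hup, hlow⟩ := ih (by omega)
      (M := (M₁.tick c).tick k) hf₁ hs₁ hg
    obtain ⟨e, hr', he, -⟩ := runsFold_pass hp (by omega) hk (hfull.mono (by omega))
      (π := transversal p k (j + 1))
      ((List.range' (j + 1 + 1) (k + 1 - (j + 1 + 1))).map p) fun τ hτ => by
        simp only [List.mem_map, List.mem_range'_1] at hτ
        obtain ⟨i, hi, rfl⟩ := hτ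
        have hm := hmem i (by omega) (by omega)
        have := hm.apply_mem (a := k) (by omega)
        exact ⟨hm, hfull _ _ this.1 this.2 le_rfl⟩
    have hr'' := hr.append (RunsFold.cons (τ := p (j + 1))
      (by rw [mul_transversal_succ (by omega)]; exact hN) hr')
    rw [← gensBelow_split (by omega) (by omega), ← hg] at hr''
    refine ⟨N.tick e, runs_B_new (by rw [ha, hs, if_neg (by omega)]) ?_, hfull.tick e, ?_, hgens,
      ?_, ?_⟩
    · rw [ha]; exact hr''
    · intro m hm
      refine ⟨(hframe m hm).1.trans ?_, (hframe m hm).2.trans ?_⟩ <;>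
      simp [hM₁, State.tick, State.setSlot, hm]
    · rw [length_gensBelow] at hc
      rw [List.length_map, List.length_range'] at he
      change N.clock + e ≤ _
      change N.clock ≤ M.clock + (1 + k) + c + k + _ at hup
      have : (j + 1 - 2) * (3 * k ^ 2) + (k + 1 - (j + 1 + 1)) * (3 * k ^ 2) ≤
          k * (3 * k ^ 2) := by
        rw [← add_mul]
        exact Nat.mul_le_mul_right _ (by omega)
      nlinarith [Nat.pow_le_pow_left (show 2 ≤ k by omega) 2]
    · rw [Finset.sum_Icc_succ_top (by omega)]
      change _ ≤ N.clock + e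
      change M.clock + (1 + k) + c + k + _ ≤ N.clock at hlow
      omega

/-! ### One generator -/

/-- The situation in which the generator `π_k` has just been added to `T(n), …, T(m+1)` and
`π_2, …, π_{k-1}` have been treated completely. -/
structure Waiting (p : ℕ → Perm ℕ) (n k m : ℕ) (M : State) : Prop where
  full : Full p (k - 1) M
  slot : ∀ l, k ≤ l → ∀ j, M.slot l j = if j = l then some 1 else none
  idx : ∀ l, k ≤ l → M.idx l = [l]
  gens_le : ∀ l, k ≤ l → l ≤ m → M.gens l = gensBelow p k
  gens_gt : ∀ l, m < l → l ≤ n → M.gens l = gensBelow p (k + 1)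

lemma Waiting.tick {k m : ℕ} {M : State} (h : Waiting p n k m M) (c : ℕ) :
    Waiting p n k m (M.tick c) := ⟨h.full, h.slot, h.idx, h.gens_le, h.gens_gt⟩

lemma Waiting.addGen {k m : ℕ} {M : State} (h : Waiting p n k (m + 1) M) (hk : 2 ≤ k)
    (hm : k ≤ m + 1) : Waiting p n k m (M.addGen (m + 1) (p k)) := by
  refine ⟨h.full, h.slot, h.idx, fun l h1 h2 => ?_, fun l h1 h2 => ?_⟩
  · have : l ≠ m + 1 := by omega
    simp only [State.addGen, Function.update_of_ne this]
    exact h.gens_le l h1 (by omega)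
  · rcases eq_or_ne l (m + 1) with rfl | e
    · simp only [State.addGen, Function.update_self]
      rw [h.gens_le _ hm le_rfl, gensBelow_succ hk]
    · simp only [State.addGen, Function.update_of_ne e]
      exact h.gens_gt l (by omega) h2

/-- π_k passes the levels above k through identities and then meets the empty slot σ_{k,k-1}. -/
lemma Waiting.memberTest_eq_false {k m m' : ℕ} {M : State} (h : Waiting p n k m' M)
    (hp : IsGenFamily p n) (hk : 2 ≤ k) (hkn : k ≤ n) (hm : k ≤ m) :
    (memberTest M m (p k)).1 = false := by
  have hpk := hp k hk hkn
  induction m, hm using Nat.le_induction with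
  | base =>
    obtain ⟨k, rfl⟩ := Nat.exists_eq_add_of_le' (show 1 ≤ k by omega)
    rw [memberTest]
    have := h.slot (k + 1) le_rfl (p (k + 1) (k + 1))
    rw [hpk.2, if_neg (by omega)] at this
    simp only [hpk.2, this]
  | succ m hm ih =>
    rw [memberTest]
    have := h.slot (m + 1) (by omega) (m + 1)
    rw [if_pos rfl] at this
    simp only [hpk.1.apply_of_lt (Nat.lt_succ_of_le hm), this]
    exact ih

/-- The number of steps of the tests for the `σ_{kj} π_i`, `1 < i < j < k`. -/
def levelCost (p : ℕ → Perm ℕ) (k : ℕ) : ℕ :=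
  ∑ j ∈ Finset.Icc 1 (k - 1), ∑ i ∈ Finset.Ico 2 j, conjCost p k j i

/-- Above level k each call only stores π_k and hands it down, at most 4n² steps per level including
the failing test; filling level k costs at most 6n⁴. -/
lemma Waiting.exists_runs_A (hp : IsGenFamily p n) {k m : ℕ} (hk : 2 ≤ k) (hkm : k ≤ m)
    (hmn : m ≤ n) {M : State} (hM : Waiting p n k m M) :
    ∃ N, Runs (.A m (p k)) M N ∧ Waiting p n (k + 1) n N ∧
      N.clock ≤ M.clock + 6 * n ^ 4 + m * (4 * n ^ 2) ∧ M.clock + levelCost p k ≤ N.clock := by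
  have hpk := hp k hk (hkm.trans hmn)
  induction m, hkm using Nat.le_induction generalizing M with
  | base =>
    obtain ⟨k, rfl⟩ := Nat.exists_eq_add_of_le' (show 1 ≤ k by omega)
    have hs : transversal p (k + 1) k = p (k + 1) := by
      rw [transversal_succ le_rfl, transversal_of_le le_rfl, one_mul]
    have hM₁ := ((hM.addGen hk le_rfl).tick 1).tick (k + 1)
    set M₁ := ((M.addGen (k + 1) (p (k + 1))).tick 1).tick (k + 1) with hM₁'
    obtain ⟨N, hN, hfull, hframe, hgens, hup, hlow⟩ := exists_runs_B hp hmn (j := k)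
      (by omega) (by omega) hM₁.full (fun i => by
        rw [hM₁.slot _ le_rfl]
        rcases eq_or_ne i (k + 1) with rfl | h
        · simp [transversal_of_le]
        · rw [if_neg h, if_neg (by omega)])
      (hM₁.gens_gt _ (by omega) hmn)
    rw [hs] at hN
    refine ⟨N, runs_A_of_idx (hM.idx _ le_rfl) (by rw [hM.slot _ le_rfl, if_pos rfl]) hN,
      ⟨hfull, ?_, ?_, ?_, ?_⟩, ?_, ?_⟩
    · intro l hl j
      rw [(hframe l (by omega)).1, hM₁.slot l (by omega)]
    · intro l hl
      rw [(hframe l (by omega)).2, hM₁.idx l (by omega)]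
    · intro l hl hl'
      rw [hgens, hM₁.gens_gt l (by omega) hl']
    · intro l hl hl'
      omega
    · change N.clock ≤ M.clock + 1 + (k + 1) + _ at hup
      have h1 : k * (6 * (k + 1) ^ 3) ≤ n * (6 * n ^ 3) :=
        Nat.mul_le_mul (by omega) (Nat.mul_le_mul_left _ (Nat.pow_le_pow_left hmn 3))
      have h2 : 1 * n ≤ n * n := Nat.mul_le_mul_right _ (by omega)
      nlinarith
    · change M.clock + 1 + (k + 1) + _ ≤ N.clock at hlow
      rw [levelCost, Nat.add_sub_cancel]
      omega
  | succ m hm ih =>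
    have hM₁ := ((hM.addGen hk (by omega)).tick 1).tick (m + 1)
    set M₁ := ((M.addGen (m + 1) (p k)).tick 1).tick (m + 1) with hM₁'
    have hfix : p k (m + 1) = m + 1 := hpk.1.apply_of_lt (by omega)
    have hs : M₁.slot (m + 1) (p k (m + 1)) = some 1 := by
      rw [hfix, hM₁.slot _ (by omega), if_pos rfl]
    have ht := hM₁.memberTest_eq_false hp hk (by omega) hm
    have hc := memberTest_cost_le M₁ m (p k)
    set c := (memberTest M₁ m (p k)).2 with hc'
    obtain ⟨N, hN, hW, hup, hlow⟩ := ih (by omega) (hM₁.tick (1 + 0 + c))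
    refine ⟨N, runs_A_of_idx (hM.idx _ (by omega)) (by rw [hM.slot _ (by omega), if_pos rfl])
      (runs_B_fail (c := c) hs ?_ ?_), hW, ?_, ?_⟩
    · rw [inv_one, one_mul]
      exact Prod.ext ht rfl
    · rw [inv_one, one_mul, if_pos hfix]
      exact hN
    · change N.clock ≤ M.clock + 1 + (m + 1) + (1 + 0 + c) + _ + _ at hup
      nlinarith [Nat.mul_le_mul hmn hmn]
    · change M.clock + 1 + (m + 1) + (1 + 0 + c) + _ ≤ N.clock at hlow
      omega

/-! ### The whole computation -/

/-- The computation with the generators `p 2, …, p (K + 1)`, with nesting depth at most `d`. -/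
def runPrefix (p : ℕ → Perm ℕ) (n d K : ℕ) : Option State :=
  ((List.range' 2 K).map p).foldlM (init := State.init n) fun M π =>
    let r := memberTest M n π
    let M₁ := M.tick (n + r.2)
    if r.1 then some M₁ else exec d (.A n π) M₁

lemma runPrefix_succ (d K : ℕ) :
    runPrefix p n d (K + 1) = (runPrefix p n d K).bind fun M =>
      let r := memberTest M n (p (K + 2))
      let M₁ := M.tick (n + r.2)
      if r.1 then some M₁ else exec d (.A n (p (K + 2))) M₁ := by
  rw [runPrefix, List.range'_concat, List.map_append, List.foldlM_append]
  simp [runPrefix, add_comm]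

lemma waiting_init : Waiting p n 2 n (State.init n) := by
  refine ⟨fun m j h1 h2 h3 => ?_, fun _ _ _ => rfl, fun _ _ => rfl, fun _ _ _ => rfl,
    fun l h1 h2 => by omega⟩
  obtain rfl : m = 1 := by omega
  obtain rfl : j = 1 := by omega
  simp [State.init, transversal_of_le]

lemma exists_runPrefix (hp : IsGenFamily p n) {K : ℕ} (hK : K ≤ n - 1) :
    ∃ N D, (∀ d, D ≤ d → runPrefix p n d K = some N) ∧ Waiting p n (K + 2) n N ∧
      N.clock ≤ (∑ k ∈ Finset.Icc 1 n, k) + K * (6 * n ^ 4 + n * (4 * n ^ 2) + (n + n * (n + 1))) ∧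
      (∑ k ∈ Finset.Icc 1 n, k) + ∑ k ∈ Finset.Icc 2 (K + 1), levelCost p k ≤ N.clock := by
  induction K with
  | zero => exact ⟨State.init n, 0, fun _ _ => rfl, waiting_init, by simp [State.init],
      by simp [State.init]⟩
  | succ K ih =>
    obtain ⟨M, D, hD, hW, hup, hlow⟩ := ih (by omega)
    have ht := hW.memberTest_eq_false hp (by omega) (by omega) (show K + 2 ≤ n by omega)
    have hc := memberTest_cost_le M n (p (K + 2))
    obtain ⟨N, ⟨D', hD'⟩, hW', hup', hlow'⟩ :=
      (hW.tick (n + (memberTest M n (p (K + 2))).2)).exists_runs_A hp (by omega)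
        (by omega : K + 2 ≤ n) le_rfl
    refine ⟨N, max D D', fun d hd => ?_, hW', ?_, ?_⟩
    · rw [runPrefix_succ, hD d ((le_max_left _ _).trans hd), Option.bind_some]
      simp only [ht]
      exact hD' d ((le_max_right _ _).trans hd)
    · change N.clock ≤ M.clock + (n + (memberTest M n (p (K + 2))).2) + _ + _ at hup'
      rw [add_mul]
      omega
    · change M.clock + (n + (memberTest M n (p (K + 2))).2) + _ ≤ N.clock at hlow'
      rw [Finset.sum_Icc_succ_top (by omega)]
      rw [show K + 1 + 1 = K + 2 from rfl]
      omega

lemma Input.isGenFamily (x : Input n) : IsGenFamily x.perm n := fun k h2 hk => by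
  rw [Input.perm, dif_pos (Finset.mem_Icc.2 ⟨h2, hk⟩)]
  exact (x ⟨k, Finset.mem_Icc.2 ⟨h2, hk⟩⟩).2

/-- The state on termination. -/
noncomputable def finalState (n : ℕ) (x : Input n) : State :=
  (exists_runPrefix x.isGenFamily (le_refl (n - 1))).choose

lemma finalState_spec (x : Input n) :
    (∃ D, ∀ d, D ≤ d → run d x = some (finalState n x)) ∧ Full x.perm n (finalState n x) ∧
      (finalState n x).clock ≤ 20 * n ^ 5 + n ^ 2 ∧
      n + ∑ k ∈ Finset.Icc 2 n, levelCost x.perm k ≤ (finalState n x).clock := by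
  obtain ⟨D, hD, hW, hup, hlow⟩ := (exists_runPrefix x.isGenFamily (le_refl (n - 1))).choose_spec
  have hsum : ∑ k ∈ Finset.Icc 1 n, k ≤ n * n := by
    refine (Finset.sum_le_card_nsmul _ _ n fun k hk => (Finset.mem_Icc.1 hk).2).trans_eq ?_
    simp
  have hsum' : n ≤ ∑ k ∈ Finset.Icc 1 n, k := by
    rcases Nat.eq_zero_or_pos n with rfl | h
    · simp
    -- Initialization alone takes at least n steps; this settles the small n in (c).
    · exact Finset.single_le_sum (f := fun k => k) (fun _ _ => Nat.zero_le _)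
        (Finset.mem_Icc.2 ⟨h, le_rfl⟩)
  refine ⟨⟨D, hD⟩, hW.full.mono (by omega), hup.trans ?_, le_trans ?_ hlow⟩
  · rcases Nat.eq_zero_or_pos n with rfl | h
    · simp
    have h1 : (n - 1) * (6 * n ^ 4 + n * (4 * n ^ 2) + (n + n * (n + 1))) ≤
        n * (20 * n ^ 4) := by
      refine Nat.mul_le_mul (by omega) ?_
      have a1 : n ^ 1 ≤ n ^ 4 := Nat.pow_le_pow_right h (by omega)
      have a2 : n ^ 2 ≤ n ^ 4 := Nat.pow_le_pow_right h (by omega)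
      have a3 : n ^ 3 ≤ n ^ 4 := Nat.pow_le_pow_right h (by omega)
      nlinarith
    nlinarith
  · rcases Nat.eq_zero_or_pos n with rfl | h
    · simp
    · rw [show n - 1 + 1 = n by omega]
      omega

/-! ### The membership tests for `σ_{kj} π_i` -/

lemma conjugate_mem (hp : IsGenFamily p n) {k j i : ℕ} (hk : k ≤ n) (hj : j < k) (hij : i < j)
    (hi : 1 < i) : MemPi (k - 1) (conjugate p k j i) := by
  obtain ⟨k, rfl⟩ := Nat.exists_eq_add_of_le' (show 1 ≤ k by omega)
  have hpi := hp i hi (by omega)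
  have ht := transversal_mem hp hk (show 1 ≤ j by omega)
  have ha := transversal_apply hp hk (show 1 ≤ j by omega) hj.le
  refine MemPi.of_succ ((ht.inv.mul (hpi.1.mono (by omega))).mul ht) ?_
  change conjugate p (k + 1) j i (k + 1) = k + 1
  rw [conjugate, Perm.mul_apply, Perm.mul_apply, ha, hpi.1.apply_of_lt hij, Perm.inv_eq_iff_eq, ha]

lemma testIndex_finalState (x : Input n) {k j i l : ℕ} (hk : k ≤ n) (hj : j < k) (hij : i < j)
    (hi : 1 < i) (hl : l < k) (hil : i < l) :
    testIndex (finalState n x) k j (x.perm i) l =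
      some (residue x.perm (k - 1) l (conjugate x.perm k j i) l) := by
  obtain ⟨-, hfull, -⟩ := finalState_spec x
  have hp := x.isGenFamily
  have hpi := hp i hi (by omega)
  have ht := transversal_mem hp hk (show 1 ≤ j by omega)
  have ha := transversal_apply hp hk (show 1 ≤ j by omega) hj.le
  rw [testIndex, hfull k j (by omega) hj.le hk, Option.bind_some]
  change siftIndex _ k (x.perm i * transversal x.perm k j) l = _
  rw [siftIndex_of_full hp (hfull.mono hk) hk (by omega) hl.le
    ((hpi.1.mono (by omega)).mul ht)]
  obtain ⟨k, rfl⟩ := Nat.exists_eq_add_of_le' (show 1 ≤ k by omega)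
  rw [residue_succ (by omega), Perm.mul_apply, ha, hpi.1.apply_of_lt hij, ← mul_assoc]
  rfl

/-! ### Changing the input -/

lemma Input.perm_of_not_mem (x : Input n) {k : ℕ} (h : ¬ (2 ≤ k ∧ k ≤ n)) : x.perm k = 1 :=
  dif_neg (by rwa [Finset.mem_Icc])

lemma Input.perm_injective : Function.Injective (Input.perm (n := n)) := fun x y h => by
  funext k
  have := congrFun h k
  rw [Input.perm, Input.perm, dif_pos k.2, dif_pos k.2] at this
  exact Subtype.ext this

open Classical in
/-- The input with the generators `p 2, …, p n`, where inadmissible ones are replaced by those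
of `x`. -/
noncomputable def Input.ofFamily (x : Input n) (p : ℕ → Perm ℕ) : Input n := fun k =>
  if h : MemPi k (p k) ∧ p k k = k - 1 then ⟨p k, h⟩ else x k

lemma Input.perm_ofFamily (x : Input n) (hp : IsGenFamily p n)
    (h : ∀ k, ¬ (2 ≤ k ∧ k ≤ n) → p k = 1) : (x.ofFamily p).perm = p := by
  funext k
  by_cases hk : 2 ≤ k ∧ k ≤ n
  · rw [Input.perm, dif_pos (Finset.mem_Icc.2 hk)]
    exact congrArg Subtype.val (dif_pos (hp k hk.1 hk.2))
  · rw [Input.perm_of_not_mem _ hk, h k hk]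

/-! ### The case in which the residue changes above level `l` -/

/-- Change `π_m` and `π_k` so that `σ_{kj}` is unchanged, while the product `ρσ_{m,j_m}⁻` is
multiplied on the left by `θ`. -/
def twist (p : ℕ → Perm ℕ) (k j m : ℕ) (ρ θ : Perm ℕ) : ℕ → Perm ℕ :=
  let A := (transversal p (m - 1) (ρ m))⁻¹ * ρ
  let q := Function.update p m (A * θ * A⁻¹ * p m)
  Function.update q k ((transversal q (k - 1) j)⁻¹ * transversal p k j)

section twist

variable {k j m : ℕ} {ρ θ : Perm ℕ}

lemma twist_of_ne {a : ℕ} (hm : a ≠ m) (hk : a ≠ k) : twist p k j m ρ θ a = p a := by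
  simp [twist, hm, hk]

lemma twist_apply_left (h : m ≠ k) : twist p k j m ρ θ m =
    (transversal p (m - 1) (ρ m))⁻¹ * ρ * θ * ((transversal p (m - 1) (ρ m))⁻¹ * ρ)⁻¹ * p m := by
  simp [twist, h]

lemma twist_apply_right : twist p k j m ρ θ k =
    (transversal (twist p k j m ρ θ) (k - 1) j)⁻¹ * transversal p k j := by
  rcases Nat.eq_zero_or_pos k with rfl | h
  · simp [twist, transversal]
  rw [transversal_congr (p := twist p k j m ρ θ) (q := Function.update p m _)]
  · exact Function.update_self _ _ _
  · intro a _ ha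
    exact Function.update_of_ne (by omega) _ _

lemma transversal_twist_right (h : j < k) :
    transversal (twist p k j m ρ θ) k j = transversal p k j := by
  obtain ⟨k, rfl⟩ := Nat.exists_eq_add_of_le' (show 1 ≤ k by omega)
  rw [transversal_succ (by omega), twist_apply_right, Nat.add_sub_cancel, mul_inv_cancel_left]

/-- The conjugator A in `twist` involves only ρ and generators below m, which do not change; so π_m
is multiplied twice by the same involution, and π_k is then determined by the unchanged σ_{kj}. -/
lemma twist_twist (hθ : θ * θ = 1) (hm : m < k) (hj : j < k) :
    twist (twist p k j m ρ θ) k j m ρ θ = p := by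
  have key : ∀ a, a ≠ k → twist (twist p k j m ρ θ) k j m ρ θ a = p a := fun a ha => by
    rcases eq_or_ne a m with rfl | h
    · have : transversal (twist p k j a ρ θ) (a - 1) (ρ a) = transversal p (a - 1) (ρ a) := by
        rcases Nat.eq_zero_or_pos a with rfl | h
        · rfl
        · exact transversal_congr fun b _ hb => twist_of_ne (by omega) (by omega)
      rw [twist_apply_left ha, this, twist_apply_left ha]
      generalize (transversal p (a - 1) (ρ a))⁻¹ * ρ = A
      rw [show A * θ * A⁻¹ * (A * θ * A⁻¹ * p a) = A * (θ * θ) * A⁻¹ * p a by group, hθ]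
      group
    · rw [twist_of_ne h ha, twist_of_ne h ha]
  funext a
  rcases eq_or_ne a k with rfl | h
  · obtain ⟨k, rfl⟩ := Nat.exists_eq_add_of_le' (show 1 ≤ a by omega)
    rw [twist_apply_right, transversal_twist_right hj, Nat.add_sub_cancel,
      transversal_congr (q := p) fun b _ hb => key b (by omega), transversal_succ (by omega),
      inv_mul_cancel_left]
  · exact key a h

/-- As ρ moves m, the perm A in `twist` takes m to m-1. Since θ fixes m, its conjugate fixes m-1, so
the new π_m still takes m to m-1. For π_k: the old σ_{kj} and the new σ_{k-1,j} take k and k-1,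
respectively, to j. -/
lemma isGenFamily_twist (hp : IsGenFamily p n) (hk : k ≤ n) (hj : 1 ≤ j) (hjk : j < k)
    (hm : m < k) (hρ : MemPi m ρ) (hρm : ρ m ≠ m) (hm2 : 2 ≤ m) (hθ : MemPi (m - 1) θ) :
    IsGenFamily (twist p k j m ρ θ) n := by
  have hr := hρ.apply_mem (a := m) (by omega)
  have key : IsGenFamily (twist p k j m ρ θ) (k - 1) := fun a h2 ha => by
    rcases eq_or_ne a m with rfl | h
    · have hT := (transversal_mem hp (k := a - 1) (by omega) hr.1).mono (Nat.sub_le a 1)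
      have hA := hT.inv.mul hρ
      have hpa := hp a h2 (by omega)
      rw [twist_apply_left (by omega)]
      refine ⟨((hA.mul (hθ.mono (by omega))).mul hA.inv).mul hpa.1, ?_⟩
      have e : ((transversal p (a - 1) (ρ a))⁻¹ * ρ) a = a - 1 := by
        rw [Perm.mul_apply, Perm.inv_eq_iff_eq, transversal_apply hp (by omega) hr.1 (by omega)]
      rw [Perm.mul_apply, Perm.mul_apply, Perm.mul_apply, hpa.2, Perm.inv_eq_iff_eq.2 e.symm,
        hθ.apply_of_lt (by omega), e]
    · rw [twist_of_ne h (by omega)]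
      exact hp a h2 (by omega)
  intro a h2 ha
  rcases eq_or_ne a k with rfl | h
  · rw [twist_apply_right]
    refine ⟨((transversal_mem key le_rfl hj).mono (Nat.sub_le a 1)).inv.mul
      (transversal_mem hp hk hj), ?_⟩
    rw [Perm.mul_apply, transversal_apply hp hk hj hjk.le, Perm.inv_eq_iff_eq,
      transversal_apply key le_rfl hj (by omega)]
  · rcases eq_or_ne a m with rfl | h'
    · exact key a h2 (by omega)
    · rw [twist_of_ne h' h]
      exact hp a h2 ha

lemma residue_twist {l : ℕ} (hl : l < m) (hm : m < k) (hρ : MemPi m ρ) (hρm : ρ m ≠ m)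
    (hθ : MemPi l θ) (hθ2 : θ * θ = 1) :
    residue (twist p k j m ρ θ) (k - 1) l ρ = residue p (k - 1) l ρ * θ := by
  have hr := hρ.apply_mem (a := m) (by omega)
  rw [residue_of_mem hρ (by omega) hl.le, residue_of_mem (p := p) hρ (by omega) hl.le]
  obtain ⟨m, rfl⟩ := Nat.exists_eq_add_of_le' (show 1 ≤ m by omega)
  rw [residue_succ (by omega), residue_succ (by omega), ← residue_mul hθ,
    residue_congr (q := p) fun a ha => twist_of_ne (by omega) (by omega)]
  congr 1
  rw [transversal_succ (by omega), transversal_succ (by omega), twist_apply_left (by omega),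
    transversal_congr (q := p) fun a _ ha => twist_of_ne (by omega) (by omega),
    Nat.add_sub_cancel]
  simp only [mul_inv_rev, inv_inv, mul_assoc, mul_inv_cancel_left, inv_mul_cancel,
    mul_one]
  rw [← eq_inv_of_mul_eq_one_left hθ2]

end twist

/-- The largest point that is moved by `ρ`, among the points `≤ k`. -/
def maxMoved (k : ℕ) (ρ : Perm ℕ) : ℕ := Nat.findGreatest (fun m => ρ m ≠ m) k

lemma maxMoved_spec {k l : ℕ} {ρ : Perm ℕ} (hρ : MemPi k ρ) (hl : ¬ MemPi l ρ) :
    l < maxMoved k ρ ∧ maxMoved k ρ ≤ k ∧ MemPi (maxMoved k ρ) ρ ∧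
      ρ (maxMoved k ρ) ≠ maxMoved k ρ := by
  have h0 : ρ 0 = 0 := hρ 0 (by omega)
  obtain ⟨a, ha⟩ := not_forall.1 hl
  rw [Classical.not_imp] at ha
  -- The moved point a is not 0, so it exceeds l; in particular `Nat.findGreatest` does not return
  -- its default value.
  have ha0 : a ≠ 0 := by rintro rfl; exact ha.2 h0
  have hak : a ≤ k := by
    by_contra h
    exact ha.2 (hρ.apply_of_lt (by omega))
  have h1 : a ≤ maxMoved k ρ := Nat.le_findGreatest hak ha.2
  refine ⟨by omega, Nat.findGreatest_le k, fun b hb => ?_,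
    Nat.findGreatest_spec (P := fun m => ρ m ≠ m) hak ha.2⟩
  by_cases hb0 : b = 0
  · rw [hb0, h0]
  · by_cases hbk : b ≤ k
    · exact not_not.1 (Nat.findGreatest_is_greatest (P := fun m => ρ m ≠ m) (n := k)
        (by change maxMoved k ρ < b; omega) hbk)
    · exact hρ.apply_of_lt (by omega)

lemma conjugate_congr {q : ℕ → Perm ℕ} {k j i : ℕ} (h : transversal p k j = transversal q k j)
    (hi : p i = q i) : conjugate p k j i = conjugate q k j i := by
  rw [conjugate, conjugate, h, hi]

/-- The condition `F` depends on `π_2, …, π_l` only. -/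
def DependsUpTo (l : ℕ) (F : Input n → Prop) : Prop :=
  ∀ x y : Input n, (∀ m, m ≤ l → x.perm m = y.perm m) → F x → F y

open Classical in
-- For each t ≤ l, the twist by (l t) is an involution of the inputs concerned. It preserves ρ,
-- hence also m, and exchanges the events that the residue takes l, respectively t, to l.
lemma mul_card_fixed_le {k j i l : ℕ} (hk : k ≤ n) (hj : j < k) (hij : i < j) (hi : 1 < i)
    (hl : l < k) (hil : i < l) {F : Input n → Prop} (hF : DependsUpTo l F) :
    l * (Finset.univ.filter fun x : Input n => F x ∧ ¬ MemPi l (conjugate x.perm k j i) ∧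
        residue x.perm (k - 1) l (conjugate x.perm k j i) l = l).card ≤
      (Finset.univ.filter F).card := by
  set S : Finset (Input n) :=
    Finset.univ.filter fun x => F x ∧ ¬ MemPi l (conjugate x.perm k j i) with hS
  set ρ : Input n → Perm ℕ := fun x => conjugate x.perm k j i with hρ
  set Φ : ℕ → Input n → Input n := fun t x =>
    x.ofFamily (twist x.perm k j (maxMoved (k - 1) (ρ x)) (ρ x) (swap l t)) with hΦ
  have spec : ∀ x ∈ S, l < maxMoved (k - 1) (ρ x) ∧ maxMoved (k - 1) (ρ x) ≤ k - 1 ∧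
      MemPi (maxMoved (k - 1) (ρ x)) (ρ x) ∧
      ρ x (maxMoved (k - 1) (ρ x)) ≠ maxMoved (k - 1) (ρ x) := fun x hx =>
    maxMoved_spec (conjugate_mem x.isGenFamily hk hj hij hi) (Finset.mem_filter.1 hx).2.2
  have hperm : ∀ t ∈ Finset.Icc 1 l, ∀ x ∈ S, (Φ t x).perm =
      twist x.perm k j (maxMoved (k - 1) (ρ x)) (ρ x) (swap l t) := fun t ht x hx => by
    obtain ⟨h1, h2, h3, h4⟩ := spec x hx
    rw [Finset.mem_Icc] at ht
    have hsw : MemPi l (swap l t) := memPi_swap (by omega) ht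
    refine Input.perm_ofFamily x (isGenFamily_twist x.isGenFamily hk (by omega) hj (by omega) h3 h4
      (by omega) (hsw.mono (by omega))) fun a ha => ?_
    rw [twist_of_ne (by omega) (by omega), x.perm_of_not_mem ha]
  have hconj : ∀ t ∈ Finset.Icc 1 l, ∀ x ∈ S, ρ (Φ t x) = ρ x := fun t ht x hx => by
    have := spec x hx
    refine conjugate_congr ?_ ?_ <;> rw [hperm t ht x hx]
    · exact transversal_twist_right hj
    · exact twist_of_ne (by omega) (by omega)
  have hmaps : ∀ t ∈ Finset.Icc 1 l, ∀ x ∈ S, Φ t x ∈ S := fun t ht x hx => by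
    have h1 := hconj t ht x hx
    have h3 := spec x hx
    have h2 := (Finset.mem_filter.1 hx).2
    refine Finset.mem_filter.2 ⟨Finset.mem_univ _, hF x _ (fun m hm => ?_) h2.1, ?_⟩
    · rw [hperm t ht x hx, twist_of_ne (by omega) (by omega)]
    · change ¬ MemPi l (ρ _)
      rw [h1]
      exact h2.2
  have hinv : ∀ t ∈ Finset.Icc 1 l, ∀ x ∈ S, Φ t (Φ t x) = x := fun t ht x hx => by
    apply Input.perm_injective
    have := spec x hx
    rw [hperm t ht _ (hmaps t ht x hx), hconj t ht x hx, hperm t ht x hx,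
      twist_twist (swap_mul_self _ _) (by omega) hj]
  have hcard : ∀ t ∈ Finset.Icc 1 l,
      (S.filter fun x => residue x.perm (k - 1) l (ρ x) l = l).card =
        (S.filter fun x => residue x.perm (k - 1) l (ρ x) t = l).card := fun t ht => by
    have key : ∀ x ∈ S, residue (Φ t x).perm (k - 1) l (ρ (Φ t x)) =
        residue x.perm (k - 1) l (ρ x) * swap l t := fun x hx => by
      obtain ⟨h1, h2, h3, h4⟩ := spec x hx
      rw [hconj t ht x hx, hperm t ht x hx]
      exact residue_twist h1 (by omega) h3 h4
        (memPi_swap (by omega) (Finset.mem_Icc.1 ht)) (swap_mul_self _ _)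
    refine Finset.card_nbij' (Φ t) (Φ t) ?_ ?_ ?_ ?_
    · intro x hx
      obtain ⟨hx, h⟩ := Finset.mem_filter.1 hx
      refine Finset.mem_coe.2 (Finset.mem_filter.2 ⟨hmaps t ht x hx, ?_⟩)
      rw [key x hx, Perm.mul_apply, swap_apply_right, h]
    · intro x hx
      obtain ⟨hx, h⟩ := Finset.mem_filter.1 hx
      refine Finset.mem_coe.2 (Finset.mem_filter.2 ⟨hmaps t ht x hx, ?_⟩)
      rw [key x hx, Perm.mul_apply, swap_apply_left, h]
    · exact fun x hx => hinv t ht x (Finset.mem_filter.1 hx).1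
    · exact fun x hx => hinv t ht x (Finset.mem_filter.1 hx).1
  -- A residue is injective, so at most one t is taken to l.
  have hle : ∑ t ∈ Finset.Icc 1 l,
      (S.filter fun x => residue x.perm (k - 1) l (ρ x) t = l).card ≤ S.card := by
    simp_rw [Finset.card_filter]
    rw [Finset.sum_comm, Finset.card_eq_sum_ones]
    refine Finset.sum_le_sum fun x _ => ?_
    rw [← Finset.card_filter]
    refine Finset.card_le_one.2 fun a ha b hb => ?_
    exact (residue x.perm (k - 1) l (ρ x)).injective
      ((Finset.mem_filter.1 ha).2.trans (Finset.mem_filter.1 hb).2.symm)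
  rw [← Finset.sum_congr rfl hcard, Finset.sum_const, Nat.card_Icc, Nat.add_sub_cancel,
    smul_eq_mul] at hle
  refine le_trans (le_of_eq ?_) (hle.trans (Finset.card_le_card ?_))
  · congr 2
    ext x
    simp only [hS, Finset.mem_filter, Finset.mem_univ, true_and, and_assoc, hρ]
  · intro x hx
    exact Finset.mem_filter.2 ⟨Finset.mem_univ _, (Finset.mem_filter.1 hx).2.1⟩

/-! ### The case in which the residue does not change above level `l` -/

/-- The points `iσ_{kj}⁻` and `(i-1)σ_{kj}⁻`. -/
def pointPair (p : ℕ → Perm ℕ) (k j i : ℕ) : ℕ × ℕ :=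
  ((transversal p k j)⁻¹ i, (transversal p k j)⁻¹ (i - 1))

lemma pointPair_mem (hp : IsGenFamily p n) {k j i : ℕ} (hk : k ≤ n) (hj : j < k) (hij : i < j)
    (hi : 1 < i) : pointPair p k j i ∈ (Finset.Icc 1 (k - 1)).offDiag := by
  have ht := (transversal_mem hp hk (show 1 ≤ j by omega)).inv
  have ha := transversal_apply hp hk (show 1 ≤ j by omega) hj.le
  have key : ∀ a, 1 ≤ a → a < j → (transversal p k j)⁻¹ a ∈ Finset.Icc 1 (k - 1) :=
    fun a h1 h2 => by
      have := ht.apply_mem (a := a) (by omega)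
      have hne : (transversal p k j)⁻¹ a ≠ k := fun e => by
        rw [Perm.inv_eq_iff_eq, ha] at e
        omega
      rw [Finset.mem_Icc]
      omega
  refine Finset.mem_offDiag.2 ⟨key _ (by omega) hij, key _ (by omega) (by omega), fun h => ?_⟩
  have := (transversal p k j)⁻¹.injective h
  omega

/-- π_i moves both i and i-1, so the conjugate moves their images under σ_{kj}⁻; every point it
moves is < l. -/
lemma pointPair_mem_of_fixed (hp : IsGenFamily p n) {k j i l : ℕ} (hk : k ≤ n) (hj : j < k)
    (hij : i < j) (hi : 1 < i) (hl : MemPi l (conjugate p k j i)) (hfix : conjugate p k j i l = l) :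
    pointPair p k j i ∈ (Finset.Icc 1 (l - 1)).offDiag := by
  have hpi := hp i hi (by omega)
  have key : ∀ a, p i a ≠ a → (transversal p k j)⁻¹ a ∈ Finset.Icc 1 (l - 1) := fun a h => by
    have hne : conjugate p k j i ((transversal p k j)⁻¹ a) ≠ (transversal p k j)⁻¹ a := by
      simpa [conjugate, Perm.mul_apply] using h
    have h1 : (transversal p k j)⁻¹ a ≠ l := fun e => hne (by rw [e, hfix])
    have h2 : 1 ≤ (transversal p k j)⁻¹ a ∧ (transversal p k j)⁻¹ a ≤ l := by
      by_contra h
      exact hne (hl _ h)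
    rw [Finset.mem_Icc]
    omega
  have hii : p i i ≠ i := by rw [hpi.2]; omega
  refine Finset.mem_offDiag.2 ⟨key _ hii, key _ fun h => ?_,
    (Finset.mem_offDiag.1 (pointPair_mem hp hk hj hij hi)).2.2⟩
  have := (p i).injective (h.trans hpi.2.symm)
  omega

/-- Multiply `π_k` on the left by `θ`. -/
def shift (p : ℕ → Perm ℕ) (k : ℕ) (θ : Perm ℕ) : ℕ → Perm ℕ := Function.update p k (p k * θ)

lemma isGenFamily_shift (hp : IsGenFamily p n) {k : ℕ} {θ : Perm ℕ} (hθ : MemPi (k - 1) θ) :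
    IsGenFamily (shift p k θ) n := fun a h2 ha => by
  have h := hp a h2 ha
  rcases eq_or_ne a k with rfl | h'
  · rw [shift, Function.update_self]
    exact ⟨h.1.mul (hθ.mono (by omega)), by
      rw [Perm.mul_apply, hθ.apply_of_lt (by omega), h.2]⟩
  · rwa [shift, Function.update_of_ne h']

lemma transversal_shift {k j : ℕ} (h : j < k) (θ : Perm ℕ) :
    transversal (shift p k θ) k j = transversal p k j * θ := by
  obtain ⟨k, rfl⟩ := Nat.exists_eq_add_of_le' (show 1 ≤ k by omega)
  rw [transversal_succ (by omega), transversal_succ (by omega), shift, Function.update_self,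
    transversal_congr (q := p) fun a _ ha => Function.update_of_ne (by omega) _ _, mul_assoc]

lemma exists_memPi_map_pair {k a b a' b' : ℕ} (ha : 1 ≤ a ∧ a ≤ k) (hb : 1 ≤ b ∧ b ≤ k)
    (ha' : 1 ≤ a' ∧ a' ≤ k) (hb' : 1 ≤ b' ∧ b' ≤ k) (h : a ≠ b) (h' : a' ≠ b') :
    ∃ θ : Perm ℕ, MemPi k θ ∧ θ a = a' ∧ θ b = b' := by
  have hs := memPi_swap ha ha'
  refine ⟨swap (swap a a' b) b' * swap a a', (memPi_swap (hs.apply_mem hb) hb').mul hs, ?_, ?_⟩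
  · rw [Perm.mul_apply, swap_apply_left, swap_apply_of_ne_of_ne _ h']
    intro e
    have e' : swap a a' a = swap a a' b := (swap_apply_left _ _).trans e
    exact h ((swap a a').injective e')
  · rw [Perm.mul_apply, swap_apply_left]

open Classical in
-- Multiplying π_k by a perm of Π(k-1) that carries u to v maps one fibre injectively into the other
-- and keeps π_2, …, π_l. By symmetry all fibres have equal size.
lemma card_pointPair_le {k j i l : ℕ} (hk : k ≤ n) (hj : j < k) (hl : l < k)
    {F : Input n → Prop} (hF : DependsUpTo l F) {u v : ℕ × ℕ}
    (hu : u ∈ (Finset.Icc 1 (k - 1)).offDiag) (hv : v ∈ (Finset.Icc 1 (k - 1)).offDiag) :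
    (Finset.univ.filter fun x : Input n => F x ∧ pointPair x.perm k j i = u).card ≤
      (Finset.univ.filter fun x : Input n => F x ∧ pointPair x.perm k j i = v).card := by
  simp only [Finset.mem_offDiag, Finset.mem_Icc] at hu hv
  obtain ⟨θ, hθ, h1, h2⟩ := exists_memPi_map_pair hu.1 hu.2.1 hv.1 hv.2.1 hu.2.2 hv.2.2
  have hperm : ∀ x : Input n, (x.ofFamily (shift x.perm k θ⁻¹)).perm = shift x.perm k θ⁻¹ :=
    fun x => Input.perm_ofFamily x (isGenFamily_shift x.isGenFamily hθ.inv) fun a ha => by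
      rcases eq_or_ne a k with rfl | h
      · obtain rfl : a = 1 := by omega
        omega
      · rw [shift, Function.update_of_ne h, x.perm_of_not_mem ha]
  refine Finset.card_le_card_of_injOn (fun x => x.ofFamily (shift x.perm k θ⁻¹)) ?_ ?_
  · intro x hx
    have hx := (Finset.mem_filter.1 hx).2
    refine Finset.mem_coe.2 (Finset.mem_filter.2 ⟨Finset.mem_univ _,
      hF x _ (fun m hm => ?_) hx.1, ?_⟩)
    · rw [hperm, shift, Function.update_of_ne (by omega)]
    · rw [hperm, pointPair, transversal_shift hj, mul_inv_rev, inv_inv, Perm.mul_apply,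
        Perm.mul_apply]
      obtain ⟨e1, e2⟩ := Prod.ext_iff.1 hx.2
      exact Prod.ext ((congrArg θ e1).trans h1) ((congrArg θ e2).trans h2)
  · intro x _ y _ h
    apply Input.perm_injective
    have h := congrArg Input.perm h
    simp only [hperm] at h
    funext a
    have := congrFun h a
    rcases eq_or_ne a k with rfl | h
    · simpa [shift] using this
    · simpa [shift, Function.update_of_ne h] using this

open Classical in
lemma mul_card_memPi_le {k j i l : ℕ} (hk : k ≤ n) (hj : j < k) (hij : i < j) (hi : 1 < i)
    (hl : l < k) {F : Input n → Prop} (hF : DependsUpTo l F) :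
    (k - 1) * (k - 2) * (Finset.univ.filter fun x : Input n => F x ∧
        MemPi l (conjugate x.perm k j i) ∧ conjugate x.perm k j i l = l).card ≤
      (l - 1) * (l - 2) * (Finset.univ.filter F).card := by
  have h12 : ((1, 2) : ℕ × ℕ) ∈ (Finset.Icc 1 (k - 1)).offDiag := by
    simp only [Finset.mem_offDiag, Finset.mem_Icc]
    omega
  set N := (Finset.univ.filter fun x : Input n => F x ∧ pointPair x.perm k j i = (1, 2)).card
  have hN : ∀ u ∈ (Finset.Icc 1 (k - 1)).offDiag,
      (Finset.univ.filter fun x : Input n => F x ∧ pointPair x.perm k j i = u).card = N :=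
    fun u hu => le_antisymm (card_pointPair_le hk hj hl hF hu h12)
      (card_pointPair_le hk hj hl hF h12 hu)
  have hoff : ∀ m, (Finset.Icc 1 (m - 1)).offDiag.card = (m - 1) * (m - 2) := fun m => by
    rw [Finset.offDiag_card, Nat.card_Icc, Nat.add_sub_cancel]
    rw [← Nat.mul_sub_one, Nat.sub_sub]
  have hall : (Finset.univ.filter F).card = (k - 1) * (k - 2) * N := by
    rw [Finset.card_eq_sum_card_fiberwise (f := fun x : Input n => pointPair x.perm k j i)
      (t := (Finset.Icc 1 (k - 1)).offDiag)
      (fun x _ => pointPair_mem x.isGenFamily hk hj hij hi)]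
    simp_rw [Finset.filter_filter]
    rw [Finset.sum_congr rfl hN, Finset.sum_const, hoff, smul_eq_mul]
  have hsub : (Finset.Icc 1 (l - 1)).offDiag ⊆ (Finset.Icc 1 (k - 1)).offDiag :=
    Finset.offDiag_mono (Finset.Icc_subset_Icc le_rfl (by omega))
  have hev : (Finset.univ.filter fun x : Input n => F x ∧
      MemPi l (conjugate x.perm k j i) ∧ conjugate x.perm k j i l = l).card ≤
        (l - 1) * (l - 2) * N := by
    rw [Finset.card_eq_sum_card_fiberwise (f := fun x : Input n => pointPair x.perm k j i)
      (t := (Finset.Icc 1 (l - 1)).offDiag) (fun x hx => by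
        have hx := (Finset.mem_filter.1 hx).2
        exact pointPair_mem_of_fixed x.isGenFamily hk hj hij hi hx.2.1 hx.2.2)]
    rw [← hoff, ← smul_eq_mul, ← Finset.sum_const]
    refine Finset.sum_le_sum fun u hu => ?_
    rw [← hN u (hsub hu)]
    refine Finset.card_le_card fun x hx => ?_
    simp only [Finset.mem_filter, Finset.mem_univ, true_and] at hx ⊢
    exact ⟨hx.1.1, hx.2⟩
  calc _ ≤ (k - 1) * (k - 2) * ((l - 1) * (l - 2) * N) := Nat.mul_le_mul_left _ hev
    _ = _ := by rw [hall]; ring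

/-! ### The probability that a level of the test is passed without multiplication -/

open Classical in
lemma card_fixed_lt {k j i l : ℕ} (hk : k ≤ n) (hj : j < k) (hij : i < j) (hi : 1 < i)
    (hl : l < k) (hil : i < l) {F : Input n → Prop} (hF : DependsUpTo l F)
    (hne : ∃ x, F x) :
    ((Finset.univ.filter fun x : Input n =>
        residue x.perm (k - 1) l (conjugate x.perm k j i) l = l ∧ F x).card : ℝ) /
      (Finset.univ.filter F).card < 1 / (l : ℝ) + (l : ℝ) ^ 2 / (k : ℝ) ^ 2 := by
  have h1 := mul_card_fixed_le hk hj hij hi hl hil hF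
  have h2 := mul_card_memPi_le hk hj hij hi hl hF
  set a := (Finset.univ.filter fun x : Input n => F x ∧ ¬ MemPi l (conjugate x.perm k j i) ∧
        residue x.perm (k - 1) l (conjugate x.perm k j i) l = l).card
  set b := (Finset.univ.filter fun x : Input n => F x ∧
        MemPi l (conjugate x.perm k j i) ∧ conjugate x.perm k j i l = l).card
  set N := (Finset.univ.filter F).card with hN
  have hN0 : 0 < N := by
    obtain ⟨x, hx⟩ := hne
    exact Finset.card_pos.2 ⟨x, Finset.mem_filter.2 ⟨Finset.mem_univ _, hx⟩⟩
  have h3 : (Finset.univ.filter fun x : Input n =>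
      residue x.perm (k - 1) l (conjugate x.perm k j i) l = l ∧ F x).card ≤ a + b := by
    refine le_trans (Finset.card_le_card fun x hx => ?_) (Finset.card_union_le _ _)
    simp only [Finset.mem_union, Finset.mem_filter, Finset.mem_univ, true_and] at hx ⊢
    by_cases h : MemPi l (conjugate x.perm k j i)
    · rw [residue_of_mem h (by omega) le_rfl, residue_of_le le_rfl] at hx
      exact Or.inr ⟨hx.2, h, hx.1⟩
    · exact Or.inl ⟨hx.2, h, hx.1⟩
  -- Here 1 < i < l forces l ≥ 3; the shift removes truncated subtraction. Strictness comes from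
  -- (l-1)/(k-1) < l/k and (l-2)/(k-2) < l/k.
  obtain ⟨l, rfl⟩ := Nat.exists_eq_add_of_le' (show 3 ≤ l by omega)
  obtain ⟨e, rfl⟩ := Nat.exists_eq_add_of_lt hl
  have h1' : ((l + 3 : ℕ) : ℝ) * a ≤ N := by exact_mod_cast h1
  have h3' : ((Finset.univ.filter fun x : Input n =>
      residue x.perm (l + 3 + e + 1 - 1) (l + 3) (conjugate x.perm (l + 3 + e + 1) j i) (l + 3) =
        l + 3 ∧ F x).card : ℝ) ≤ a + b := by exact_mod_cast h3
  have h2' : ((l : ℝ) + e + 3) * (l + e + 2) * b ≤ (l + 2) * (l + 1) * N := by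
    have : (l + e + 3) * (l + e + 2) * b ≤ (l + 2) * (l + 1) * N := by
      rw [show l + 3 + e + 1 - 1 = l + e + 3 by omega,
        show l + 3 + e + 1 - 2 = l + e + 2 by omega] at h2
      exact h2
    exact_mod_cast this
  have hN' : (0 : ℝ) < N := by exact_mod_cast hN0
  have hl' : (0 : ℝ) ≤ l := Nat.cast_nonneg l
  have he' : (0 : ℝ) ≤ e := Nat.cast_nonneg e
  push_cast at h1' ⊢
  have ha : (a : ℝ) / N ≤ 1 / (l + 3) := by
    rw [div_le_div_iff₀ hN' (by positivity)]
    linarith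
  have hb : (b : ℝ) / N ≤ ((l + 2) / (l + e + 3)) * ((l + 1) / (l + e + 2)) := by
    rw [div_mul_div_comm, div_le_div_iff₀ hN' (by positivity)]
    linarith
  have hc1 : ((l : ℝ) + 2) / (l + e + 3) < (l + 3) / (l + 3 + e + 1) := by
    rw [div_lt_div_iff₀ (by positivity) (by positivity)]
    nlinarith
  have hc2 : ((l : ℝ) + 1) / (l + e + 2) < (l + 3) / (l + 3 + e + 1) := by
    rw [div_lt_div_iff₀ (by positivity) (by positivity)]
    nlinarith
  have hc := mul_lt_mul'' hc1 hc2 (by positivity) (by positivity)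
  calc _ ≤ ((a : ℝ) + b) / N := (div_le_div_iff_of_pos_right hN').2 h3'
    _ = a / N + b / N := add_div _ _ _
    _ < 1 / (l + 3) + (l + 3) / (l + 3 + e + 1) * ((l + 3) / (l + 3 + e + 1)) := by linarith
    _ = _ := by rw [div_mul_div_comm, sq, sq]

lemma condProb_lt {k j i l : ℕ} (hk : k ≤ n) (hj : j < k) (hij : i < j) (hi : 1 < i)
    (hl : l < k) (hil : i < l) {F : Input n → Prop} (hF : DependsUpTo l F) (hne : ∃ x, F x) :
    condProb (n := n)
        (fun x => testIndex (finalState n x) k j (x.perm i) l = some l) F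
      < 1 / (l : ℝ) + (l : ℝ) ^ 2 / (k : ℝ) ^ 2 := by
  have := card_fixed_lt hk hj hij hi hl hil hF hne
  have e : ∀ x : Input n, testIndex (finalState n x) k j (x.perm i) l = some l ↔
      residue x.perm (k - 1) l (conjugate x.perm k j i) l = l := fun x => by
    rw [testIndex_finalState x hk hj hij hi hl hil, Option.some_inj]
  refine lt_of_eq_of_lt ?_ this
  rw [condProb]
  congr 3
  ext x
  simp only [Finset.mem_filter, e]

/-! ### The average running time -/

instance : Nonempty (Input n) :=
  ⟨fun k => ⟨swap k (k - 1), by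
    have := Finset.mem_Icc.1 k.2
    exact ⟨memPi_swap (by omega) (by omega), swap_apply_left _ _⟩⟩⟩

lemma average_mono {f g : Input n → ℝ} (h : ∀ x, f x ≤ g x) : average f ≤ average g :=
  div_le_div_of_nonneg_right (Finset.sum_le_sum fun x _ => h x) (Nat.cast_nonneg _)

lemma average_const (c : ℝ) : average (fun _ : Input n => c) = c := by
  rw [average, Finset.sum_const, Finset.card_univ, nsmul_eq_mul,
    mul_div_cancel_left₀ _ (by exact_mod_cast Fintype.card_ne_zero)]

lemma average_sum {ι : Type*} (s : Finset ι) (f : ι → Input n → ℝ) :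
    average (fun x => ∑ i ∈ s, f i x) = ∑ i ∈ s, average (f i) := by
  simp only [average, ← Finset.sum_div]
  rw [Finset.sum_comm]

lemma exists_average_le (f : Input n → ℝ) : ∃ x, average f ≤ f x := by
  by_contra! h
  have h1 : ∑ x, f x < ∑ _x : Input n, average f :=
    Finset.sum_lt_sum_of_nonempty Finset.univ_nonempty fun x _ => h x
  have h2 : (0 : ℝ) < Fintype.card (Input n) := by exact_mod_cast Fintype.card_pos
  rw [Finset.sum_const, Finset.card_univ, nsmul_eq_mul, average, mul_div_cancel₀ _ h2.ne'] at h1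
  exact lt_irrefl _ h1

open Classical in
-- In this box l ≥ 3 and l/k < 1/2, so j_l = l has probability below 1/3 + 1/4 = 7/12; the other
-- 5/12 pay l > 2q steps.
lemma average_level_ge {q k j i l : ℕ} (hkn : k ≤ n) (hk : 8 * q < k) (hj : 2 * q < j)
    (hj' : j ≤ 8 * q) (hi : 1 < i) (hi' : i ≤ q + 1) (hl : 2 * q < l) (hl' : l ≤ 4 * q) :
    (5 / 6 * q : ℝ) ≤ average fun x : Input n =>
      if residue x.perm (k - 1) l (conjugate x.perm k j i) l = l then 0 else (l : ℝ) := by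
  have h := card_fixed_lt hkn (show j < k by omega) (show i < j by omega) hi
    (show l < k by omega) (show i < l by omega) (F := fun _ : Input n => True)
    (fun _ _ _ h => h) ⟨Classical.arbitrary _, trivial⟩
  simp only [and_true, Finset.filter_true, Finset.card_univ] at h
  set E : Input n → Prop := fun x => residue x.perm (k - 1) l (conjugate x.perm k j i) l = l
  have hW : (0 : ℝ) < Fintype.card (Input n) := by exact_mod_cast Fintype.card_pos
  have hq1 : (1 : ℝ) ≤ q := by exact_mod_cast (by omega : 1 ≤ q)
  have hl1 : (2 * q : ℝ) < l := by exact_mod_cast hl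
  have hl2 : (l : ℝ) ≤ 4 * q := by exact_mod_cast hl'
  have hk1 : (8 * q : ℝ) < k := by exact_mod_cast hk
  have hl3 : (3 : ℝ) ≤ l := by exact_mod_cast (by omega : 3 ≤ l)
  have hP : ((Finset.univ.filter E).card : ℝ) / Fintype.card (Input n) < 7 / 12 := by
    refine h.trans_le ?_
    have h1 : 1 / (l : ℝ) ≤ 1 / 3 := one_div_le_one_div_of_le (by norm_num) hl3
    have h2 : (l : ℝ) ^ 2 / (k : ℝ) ^ 2 ≤ 1 / 4 := by
      rw [div_le_div_iff₀ (by nlinarith) (by norm_num)]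
      nlinarith
    linarith
  have hsum : (average fun x : Input n => if E x then 0 else (l : ℝ)) =
      l * (1 - ((Finset.univ.filter E).card : ℝ) / Fintype.card (Input n)) := by
    have : ∀ x : Input n, (if E x then 0 else (l : ℝ)) = l - l * (if E x then 1 else 0) :=
      fun x => by split_ifs <;> simp
    rw [average, Finset.sum_congr rfl fun x _ => this x, Finset.sum_sub_distrib,
      ← Finset.mul_sum, Finset.sum_boole, Finset.sum_const, Finset.card_univ, nsmul_eq_mul]
    field_simp
  change _ ≤ average fun x : Input n => if E x then 0 else (l : ℝ)
  rw [hsum]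
  nlinarith

open Classical in
lemma sum_le_sum_levelCost {q : ℕ} (hq : 16 * q ≤ n) :
    ∑ k ∈ Finset.Ioc (8 * q) (16 * q), ∑ j ∈ Finset.Ioc (2 * q) (8 * q),
      ∑ i ∈ Finset.Ioc 1 (q + 1), ∑ l ∈ Finset.Ioc (2 * q) (4 * q),
        (if residue p (k - 1) l (conjugate p k j i) l = l then 0 else l) ≤
      ∑ k ∈ Finset.Icc 2 n, levelCost p k := by
  refine (Finset.sum_le_sum fun k hk => ?_).trans
    (Finset.sum_le_sum_of_subset (s := Finset.Ioc (8 * q) (16 * q)) fun k hk => ?_)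
  · rw [Finset.mem_Ioc] at hk
    rw [levelCost]
    refine (Finset.sum_le_sum fun j hj => ?_).trans
      (Finset.sum_le_sum_of_subset (s := Finset.Ioc (2 * q) (8 * q)) fun j hj => ?_)
    · rw [Finset.mem_Ioc] at hj
      refine (Finset.sum_le_sum fun i hi => ?_).trans
        (Finset.sum_le_sum_of_subset (s := Finset.Ioc 1 (q + 1)) fun i hi => ?_)
      · rw [conjCost, testCost]
        refine (Finset.sum_le_sum fun l hl => ?_).trans
          (Finset.sum_le_sum_of_subset (s := Finset.Ioc (2 * q) (4 * q)) fun l hl => ?_)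
        · split_ifs <;> omega
        · rw [Finset.mem_Ioc] at hl
          rw [Finset.mem_Icc]
          omega
      · rw [Finset.mem_Ioc] at hi
        rw [Finset.mem_Ico]
        omega
    · rw [Finset.mem_Ioc] at hj
      rw [Finset.mem_Icc]
      omega
  · rw [Finset.mem_Ioc] at hk
    rw [Finset.mem_Icc]
    omega

lemma average_clock_ge {q : ℕ} (hq : 16 * q ≤ n) :
    80 * (q : ℝ) ^ 5 ≤ average fun x : Input n => ((finalState n x).clock : ℝ) := by
  classical
  have h1 : ∀ x : Input n, ((∑ k ∈ Finset.Ioc (8 * q) (16 * q),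
      ∑ j ∈ Finset.Ioc (2 * q) (8 * q), ∑ i ∈ Finset.Ioc 1 (q + 1),
        ∑ l ∈ Finset.Ioc (2 * q) (4 * q),
          (if residue x.perm (k - 1) l (conjugate x.perm k j i) l = l then 0 else (l : ℝ)))) ≤
      ((finalState n x).clock : ℝ) := fun x => by
    have := (sum_le_sum_levelCost (p := x.perm) hq).trans
      (le_of_add_le_right (finalState_spec x).2.2.2)
    exact_mod_cast this
  refine le_trans ?_ (average_mono h1)
  simp only [average_sum]
  have h2 : ∑ _k ∈ Finset.Ioc (8 * q) (16 * q), ∑ _j ∈ Finset.Ioc (2 * q) (8 * q),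
      ∑ _i ∈ Finset.Ioc 1 (q + 1), ∑ _l ∈ Finset.Ioc (2 * q) (4 * q), (5 / 6 * q : ℝ) =
      80 * (q : ℝ) ^ 5 := by
    simp only [Finset.sum_const, Nat.card_Ioc, nsmul_eq_mul]
    rw [show 16 * q - 8 * q = 8 * q by omega, show 8 * q - 2 * q = 6 * q by omega,
      show q + 1 - 1 = q by omega, show 4 * q - 2 * q = 2 * q by omega]
    push_cast
    ring
  rw [← h2]
  refine Finset.sum_le_sum fun k hk => Finset.sum_le_sum fun j hj => Finset.sum_le_sum fun i hi =>
    Finset.sum_le_sum fun l hl => ?_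
  rw [Finset.mem_Ioc] at hk hj hi hl
  exact average_level_ge (by omega) hk.1 hj.1 hj.2 hi.1 hi.2 hl.1 hl.2

lemma average_clock_ge_pow (hn : 16 ≤ n) :
    80 / 31 ^ 5 * (n : ℝ) ^ 5 ≤ average fun x : Input n => ((finalState n x).clock : ℝ) := by
  refine le_trans ?_ (average_clock_ge (q := n / 16) (by omega))
  -- With q = n/16 ≥ 1 the remainder is at most 15 ≤ 15q.
  have h : (n : ℝ) ≤ 31 * (n / 16 : ℕ) := by exact_mod_cast (by omega : n ≤ 31 * (n / 16))
  have := pow_le_pow_left₀ (Nat.cast_nonneg n) h 5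
  rw [mul_pow] at this
  rw [div_mul_eq_mul_div, div_le_iff₀ (by norm_num)]
  linarith

lemma average_clock_le (hn : 1 ≤ n) :
    (average fun x : Input n => ((finalState n x).clock : ℝ)) ≤ 21 * (n : ℝ) ^ 5 := by
  rw [← average_const (n := n) (21 * (n : ℝ) ^ 5)]
  refine average_mono fun x => ?_
  have h1 := (finalState_spec x).2.2.1
  have h2 : n ^ 2 ≤ n ^ 5 := Nat.pow_le_pow_right hn (by omega)
  exact_mod_cast (by omega : (finalState n x).clock ≤ 21 * n ^ 5)

/-- The constant serves both ranges: n⁵/16⁵ ≤ 1 for n < 16, and 1/16⁵ ≤ 80/31⁵ otherwise. -/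
lemma exists_clock_ge (n : ℕ) :
    ∃ x : Input n, 1 / 16 ^ 5 * (n : ℝ) ^ 5 ≤ ((finalState n x).clock : ℝ) := by
  rcases Nat.lt_or_ge n 16 with h | h
  · refine ⟨Classical.arbitrary _, ?_⟩
    rcases Nat.eq_zero_or_pos n with rfl | h0
    · simp
    have h1 : 1 ≤ (finalState n (Classical.arbitrary _)).clock :=
      h0.trans_le (le_of_add_le_left (finalState_spec _).2.2.2)
    have h2 : (n : ℝ) ^ 5 ≤ 16 ^ 5 :=
      pow_le_pow_left₀ (Nat.cast_nonneg n) (by exact_mod_cast h.le) 5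
    calc _ ≤ (1 : ℝ) := by rw [one_div_mul_eq_div]; exact div_le_one_of_le₀ h2 (by norm_num)
      _ ≤ _ := by exact_mod_cast h1
  · obtain ⟨x, hx⟩ := exists_average_le fun x : Input n => ((finalState n x).clock : ℝ)
    refine ⟨x, le_trans ?_ ((average_clock_ge_pow h).trans hx)⟩
    exact mul_le_mul_of_nonneg_right (by norm_num) (by positivity)

end PermAlg

theorem mainTheorem4 :
    ∃ final : ∀ n : ℕ, PermAlg.Input n → PermAlg.State,
      -- the computation terminates for every input, in the state `final n x`
      (∀ (n : ℕ) (x : PermAlg.Input n),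
        ∃ D : ℕ, ∀ d : ℕ, D ≤ d → PermAlg.run d x = some (final n x)) ∧
      -- the average running time is `Θ(n⁵)`
      (fun n : ℕ => PermAlg.average fun x : PermAlg.Input n => ((final n x).clock : ℝ))
        =Θ[Filter.atTop] (fun n : ℕ => (n : ℝ) ^ 5) ∧
      -- the estimate for the membership tests of `σ_{kj} π_i` in `Γ(k)`
      (∀ n k j i l : ℕ, k ≤ n → j < k → i < j → 1 < i → l < k → i < l →
        (∀ x : PermAlg.Input n,
          (PermAlg.testIndex (final n x) k j (x.perm i) l).isSome) ∧
        PermAlg.condProb (n := n)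
            (fun x => PermAlg.testIndex (final n x) k j (x.perm i) l = some l)
            (fun _ => True)
          < 1 / (l : ℝ) + (l : ℝ) ^ 2 / (k : ℝ) ^ 2 ∧
        -- the same for arbitrary fixed `π_2, …, π_l`
        ∀ y : PermAlg.Input n,
          PermAlg.condProb (n := n)
              (fun x => PermAlg.testIndex (final n x) k j (x.perm i) l = some l)
              (fun x => ∀ m : ℕ, m ≤ l → x.perm m = y.perm m)
            < 1 / (l : ℝ) + (l : ℝ) ^ 2 / (k : ℝ) ^ 2) ∧
      -- for every `n` some input forces `Ω(n⁵)` steps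
      ∃ c : ℝ, 0 < c ∧ ∀ n : ℕ, ∃ x : PermAlg.Input n,
        c * (n : ℝ) ^ 5 ≤ ((final n x).clock : ℝ) := by
  refine ⟨PermAlg.finalState, fun n x => (PermAlg.finalState_spec x).1, ⟨?_, ?_⟩, ?_, ?_⟩
  · refine Asymptotics.IsBigO.of_bound 21 ?_
    filter_upwards [Filter.eventually_ge_atTop 1] with n hn
    have h0 : 0 ≤ PermAlg.average fun x : PermAlg.Input n =>
        ((PermAlg.finalState n x).clock : ℝ) := by
      rw [← PermAlg.average_const (n := n) 0]
      exact PermAlg.average_mono fun x => Nat.cast_nonneg _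
    rw [Real.norm_of_nonneg h0, Real.norm_of_nonneg (by positivity)]
    exact PermAlg.average_clock_le hn
  · refine Asymptotics.IsBigO.of_bound (31 ^ 5 / 80) ?_
    filter_upwards [Filter.eventually_ge_atTop 16] with n hn
    have h := PermAlg.average_clock_ge_pow hn
    rw [Real.norm_of_nonneg (by positivity), Real.norm_of_nonneg (le_trans (by positivity) h)]
    linarith
  · intro n k j i l hk hj hij hi hl hil
    refine ⟨fun x => ?_, ?_, fun y => ?_⟩
    · rw [PermAlg.testIndex_finalState x hk hj hij hi hl hil]
      rfl
    · exact PermAlg.condProb_lt hk hj hij hi hl hil (fun _ _ _ h => h)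
        ⟨Classical.arbitrary _, trivial⟩
    · exact PermAlg.condProb_lt hk hj hij hi hl hil
        (fun x x' h hx m hm => (h m hm).symm.trans (hx m hm)) ⟨y, fun _ _ => rfl⟩
  · exact ⟨1 / 16 ^ 5, by norm_num, PermAlg.exists_clock_ge⟩
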